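/- Let $d\ge 3$, let $\mathbb{D}\subset\mathbb{R}^d$ be the open unit ball, and let $H(\mathbb{D})$ be the space of real harmonic functions on $\mathbb{D}$ with the topology of locally uniform convergence of all derivatives; let $H'(\mathbb{D})$ be its topological dual. Let $\mathrm{Harm}_{d,n}$ be the space of real homogeneous harmonic polynomials of degree $n$ in $d$ variables, with the inner product $(u,v)_{L^2(S^{d-1})}=\int_{S^{d-1}}uv\,d\sigma$, where $\sigma$ is the rotation invariant measure on the unit sphere normalized by $\sigma(S^{d-1})=1$. On $\mathrm{Harm}_d=\bigoplus_{n\ge 0}\mathrm{Harm}_{d,n}$ consider the inner product $$(u,v)_{\mathrm{CFT}}=\sum_{n\ge 0}\frac{2n+d-2}{d-2}\,(u_n,v_n)_{L^2(S^{d-1})},$$ and let $H_{\mathrm{CFT}}$ be the Hilbert space completion of $\mathrm{Harm}_d$. Map $H'(\mathbb{D})$ to $\prod_{n\ge 0}\mathrm{Harm}_{d,n}$ by $T\mapsto(t_n)_n$, where $t_n\in\mathrm{Harm}_{d,n}$ is the unique element with $(t_n,u)_{L^2(S^{d-1})}=T(u|_{\mathbb{D}})$ for all $u\in\mathrm{Harm}_{d,n}$,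 and map $H_{\mathrm{CFT}}$ to $\prod_{n\ge 0}\mathrm{Harm}_{d,n}$ by the continuous extensions of the component maps $\mathrm{Harm}_d\to\mathrm{Harm}_{d,n}$. For a real vector space $V$ write $P(V)=\bigoplus_{n\ge0}\mathrm{Sym}^n V$ for the (algebraic) symmetric algebra, and for a real Hilbert space $H$ let the Hilbert Fock space $\widehat{\mathrm{Sym}}(H)$ be the completion of $P(H)$ for the inner product in which $\mathrm{Sym}^m H\perp\mathrm{Sym}^n H$ for $m\ne n$ and $(f_1\cdots f_n,\,g_1\cdots g_n)=\sum_{\sigma\in S_n}\prod_{i=1}^n(f_i,g_{\sigma(i)})$. Then both maps into $\prod_{n\ge 0}\mathrm{Harm}_{d,n}$ are injective, and, with $H'(\mathbb{D})$ and $H_{\mathrm{CFT}}$ regarded as subspaces of this product, $$H'(\mathbb{D})\subset H_{\mathrm{CFT}}.$$ Moreover the linear map $P(H'(\mathbb{D}))\to P(H_{\mathrm{CFT}})\to\widehat{\mathrm{Sym}}(H_{\mathrm{CFT}})$ induced by this inclusion is injective, and its image is dense. -/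

import Mathlib

namespace Fock

noncomputable section
open MvPolynomial

variable {H : Type*} [NormedAddCommGroup H] [InnerProductSpace ℝ H]

/-- The algebra homomorphism `Sym H → Sym H ⊕ Sym H·ε` with `g ↦ g + ⟪f, g⟫ ε`; its
`ε`-component is the derivation in the direction `f`. -/
def shift (f : H) : SymmetricAlgebra ℝ H →ₐ[ℝ] DualNumber (SymmetricAlgebra ℝ H) :=
  SymmetricAlgebra.lift
    ((TrivSqZeroExt.inlAlgHom ℝ (SymmetricAlgebra ℝ H) (SymmetricAlgebra ℝ H)).toLinearMap ∘ₗ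
        SymmetricAlgebra.ι ℝ H +
      (TrivSqZeroExt.inrHom (SymmetricAlgebra ℝ H) (SymmetricAlgebra ℝ H)).restrictScalars ℝ ∘ₗ
        Algebra.linearMap ℝ (SymmetricAlgebra ℝ H) ∘ₗ (innerₛₗ ℝ f))

theorem fst_shift (f : H) (p : SymmetricAlgebra ℝ H) : (shift f p).fst = p := by
  have : (TrivSqZeroExt.fstHom ℝ (SymmetricAlgebra ℝ H) (SymmetricAlgebra ℝ H)).comp (shift f)
      = AlgHom.id ℝ _ := by
    apply SymmetricAlgebra.algHom_ext
    ext g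
    simp [shift]
  exact congr($this p)

/-- The annihilation operator of `f ∈ H`: the derivation of `Sym H` with `g ↦ ⟪f, g⟫` on `H`. -/
def annihilation (f : H) :
    Derivation ℝ (SymmetricAlgebra ℝ H) (SymmetricAlgebra ℝ H) :=
  Derivation.mk'
    ((TrivSqZeroExt.sndHom (SymmetricAlgebra ℝ H) (SymmetricAlgebra ℝ H)).restrictScalars ℝ ∘ₗ
      (shift f).toLinearMap) (by
    intro a b
    simp [fst_shift, mul_comm])

theorem annihilation_ι (f g : H) : annihilation f (SymmetricAlgebra.ι ℝ H g)
    = algebraMap ℝ _ (inner ℝ f g) := by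
  simp [annihilation, shift, Algebra.algebraMap_eq_smul_one]

theorem derivation_ext {D D' : Derivation ℝ (SymmetricAlgebra ℝ H) (SymmetricAlgebra ℝ H)}
    (h : ∀ g, D (SymmetricAlgebra.ι ℝ H g) = D' (SymmetricAlgebra.ι ℝ H g)) : D = D' := by
  ext p
  induction p using SymmetricAlgebra.induction with
  | algebraMap r => simp
  | ι x => exact h x
  | mul a b ha hb => simp [ha, hb]
  | add a b ha hb => simp [ha, hb]

/-- `f ↦ annihilation f`, as a linear map into the endomorphisms of `Sym H`. -/
def annihilationₗ : H →ₗ[ℝ] Module.End ℝ (SymmetricAlgebra ℝ H) where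
  toFun f := (annihilation f : SymmetricAlgebra ℝ H →ₗ[ℝ] SymmetricAlgebra ℝ H)
  map_add' f g := by
    have : annihilation (f + g) = annihilation f + annihilation g :=
      derivation_ext fun x => by simp [annihilation_ι, inner_add_left]
    rw [this]; rfl
  map_smul' c f := by
    have : annihilation (c • f) = c • annihilation f :=
      derivation_ext fun x => by
        simp [annihilation_ι, inner_smul_left, Algebra.smul_def]
    rw [this]; rfl

theorem annihilation_comm (f g : H) (p : SymmetricAlgebra ℝ H) :
    annihilation f (annihilation g p) = annihilation g (annihilation f p) := by
  have : ⁅annihilation f, annihilation g⁆ = 0 :=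
    derivation_ext fun x => by simp [Derivation.commutator_apply, annihilation_ι]
  have h := congr($this p)
  rw [Derivation.commutator_apply] at h
  exact sub_eq_zero.1 h

/-- The commutative algebra of operators generated by the annihilation operators. -/
abbrev annihilationAlgebra (H : Type*) [NormedAddCommGroup H] [InnerProductSpace ℝ H] :
    Subalgebra ℝ (Module.End ℝ (SymmetricAlgebra ℝ H)) :=
  Algebra.adjoin ℝ (Set.range (annihilationₗ (H := H)))

instance : IsMulCommutative (annihilationAlgebra H) :=
  Algebra.isMulCommutative_adjoin ℝ (by
    rintro _ ⟨f, rfl⟩ _ ⟨g, rfl⟩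
    exact LinearMap.ext fun p => annihilation_comm f g p)

open scoped IsMulCommutative in
instance : CommRing (annihilationAlgebra H) := inferInstance

/-- The algebra homomorphism `p ↦ p(∂)` from `Sym H` to operators on `Sym H` that sends `f ∈ H`
to the annihilation operator of `f`. -/
def diffOp : SymmetricAlgebra ℝ H →ₐ[ℝ] Module.End ℝ (SymmetricAlgebra ℝ H) :=
  (annihilationAlgebra H).val.comp
    (SymmetricAlgebra.lift (annihilationₗ.codRestrict (annihilationAlgebra H).toSubmodule
      fun f => Algebra.subset_adjoin ⟨f, rfl⟩))

theorem diffOp_ι (f : H) (p : SymmetricAlgebra ℝ H) :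
    diffOp (SymmetricAlgebra.ι ℝ H f) p = annihilation f p := by
  rw [diffOp, AlgHom.comp_apply, SymmetricAlgebra.lift_ι_apply]
  rfl

/-- The Fock form on `Sym H`: `⟪p, q⟫` is the constant term of `p(∂) q`. -/
def fockForm (p q : SymmetricAlgebra ℝ H) : ℝ :=
  SymmetricAlgebra.algebraMapInv (diffOp p q)

theorem fockForm_add_left (p p' q : SymmetricAlgebra ℝ H) :
    fockForm (p + p') q = fockForm p q + fockForm p' q := by
  simp [fockForm]

theorem fockForm_add_right (p q q' : SymmetricAlgebra ℝ H) :
    fockForm p (q + q') = fockForm p q + fockForm p q' := by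
  simp [fockForm]

theorem fockForm_smul_left (c : ℝ) (p q : SymmetricAlgebra ℝ H) :
    fockForm (c • p) q = c * fockForm p q := by
  simp [fockForm]

theorem fockForm_smul_right (c : ℝ) (p q : SymmetricAlgebra ℝ H) :
    fockForm p (c • q) = c * fockForm p q := by
  simp [fockForm]

theorem fockForm_ι_mul_left (f : H) (p q : SymmetricAlgebra ℝ H) :
    fockForm (SymmetricAlgebra.ι ℝ H f * p) q = fockForm p (annihilation f q) := by
  rw [fockForm, mul_comm, map_mul, Module.End.mul_apply, diffOp_ι, fockForm]

/-- Elements of `Sym H` are sums of products `f₁ ⋯ fₙ`. -/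
theorem induction_ι_mul {motive : SymmetricAlgebra ℝ H → Prop} (one : motive 1)
    (add : ∀ p q, motive p → motive q → motive (p + q))
    (smul : ∀ (c : ℝ) p, motive p → motive (c • p))
    (mul : ∀ f p, motive p → motive (SymmetricAlgebra.ι ℝ H f * p))
    (p : SymmetricAlgebra ℝ H) : motive p := by
  suffices h : ∀ q, motive q → motive (p * q) by simpa using h 1 one
  induction p using SymmetricAlgebra.induction with
  | algebraMap r => intro q hq; rw [← Algebra.smul_def]; exact smul r q hq
  | ι x => intro q hq; exact mul x q hq
  | mul a b ha hb => intro q hq; rw [mul_assoc]; exact ha _ (hb _ hq)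
  | add a b ha hb => intro q hq; rw [add_mul]; exact add _ _ (ha _ hq) (hb _ hq)

theorem fockForm_ι_mul_right (f : H) (p q : SymmetricAlgebra ℝ H) :
    fockForm p (SymmetricAlgebra.ι ℝ H f * q) = fockForm (annihilation f p) q := by
  induction p using induction_ι_mul generalizing q with
  | one => simp [fockForm, SymmetricAlgebra.algebraMapInv_ι]
  | add p p' hp hp' => rw [map_add, fockForm_add_left, fockForm_add_left, hp, hp']
  | smul c p hp => rw [Derivation.map_smul, fockForm_smul_left, fockForm_smul_left, hp]
  | mul g p hp =>
    rw [fockForm_ι_mul_left, Derivation.leibniz, Derivation.leibniz, fockForm_add_right,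
      fockForm_add_left, smul_eq_mul, smul_eq_mul, smul_eq_mul, smul_eq_mul, hp,
      fockForm_ι_mul_left, annihilation_ι, annihilation_ι, mul_comm q, mul_comm p,
      ← Algebra.smul_def, ← Algebra.smul_def, fockForm_smul_left, fockForm_smul_right,
      real_inner_comm, add_comm]

theorem fockForm_symm (p q : SymmetricAlgebra ℝ H) : fockForm p q = fockForm q p := by
  induction p using induction_ι_mul generalizing q with
  | one =>
    induction q using induction_ι_mul with
    | one => rfl
    | add p p' hp hp' => rw [fockForm_add_left, fockForm_add_right, hp, hp']
    | smul c p hp => rw [fockForm_smul_left, fockForm_smul_right, hp]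
    | mul g p hp =>
      rw [fockForm_ι_mul_left, Derivation.map_one_eq_zero]
      simp [fockForm, SymmetricAlgebra.algebraMapInv_ι]
  | add p p' hp hp' => rw [fockForm_add_left, fockForm_add_right, hp, hp']
  | smul c p hp => rw [fockForm_smul_left, fockForm_smul_right, hp]
  | mul g p hp => rw [fockForm_ι_mul_left, fockForm_ι_mul_right, hp]

/-- The algebra homomorphism `ℝ[X₁, …, X_k] → Sym H`, `X_i ↦ e_i`. -/
def polyMap {k : ℕ} (e : Fin k → H) : MvPolynomial (Fin k) ℝ →ₐ[ℝ] SymmetricAlgebra ℝ H :=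
  aeval fun i => SymmetricAlgebra.ι ℝ H (e i)

theorem annihilation_polyMap {k : ℕ} {e : Fin k → H} (he : Orthonormal ℝ e) (i : Fin k)
    (P : MvPolynomial (Fin k) ℝ) :
    annihilation (e i) (polyMap e P) = polyMap e (pderiv i P) := by
  induction P using MvPolynomial.induction_on with
  | C a => simp [polyMap]
  | add P Q hP hQ => simp [hP, hQ]
  | mul_X P j hP =>
    rw [map_mul, Derivation.leibniz, Derivation.leibniz, map_add, hP]
    simp only [smul_eq_mul, map_mul, pderiv_X]
    congr 2
    rw [polyMap, aeval_X, annihilation_ι, orthonormal_iff_ite.1 he, Pi.single_apply]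
    simp only [eq_comm (a := i)]
    split_ifs <;> simp

theorem fockForm_polyMap_monomial {k : ℕ} {e : Fin k → H} (he : Orthonormal ℝ e)
    (α : Fin k →₀ ℕ) :
    ∃ c : ℝ, 0 < c ∧ ∀ P, fockForm (polyMap e (monomial α 1)) (polyMap e P) = c * coeff α P := by
  have step : ∀ (β : Fin k →₀ ℕ) (i : Fin k),
      (∃ c : ℝ, 0 < c ∧ ∀ P,
        fockForm (polyMap e (monomial β 1)) (polyMap e P) = c * coeff β P) →
      ∃ c : ℝ, 0 < c ∧ ∀ P, fockForm (polyMap e (monomial (β + Finsupp.single i 1) 1))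
        (polyMap e P) = c * coeff (β + Finsupp.single i 1) P := by
    rintro β i ⟨c, hc, h⟩
    refine ⟨c * (β i + 1), by positivity, fun P => ?_⟩
    have h1 : (monomial (β + Finsupp.single i 1) 1 : MvPolynomial (Fin k) ℝ) =
        X i * monomial β 1 := by
      rw [X, monomial_mul, one_mul, add_comm]
    rw [h1, map_mul]
    nth_rewrite 1 [polyMap]
    rw [aeval_X, fockForm_ι_mul_left, annihilation_polyMap he, h, coeff_pderiv]
    ring
  suffices h : ∀ β : Fin k →₀ ℕ,
      (∃ c : ℝ, 0 < c ∧ ∀ P,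
        fockForm (polyMap e (monomial β 1)) (polyMap e P) = c * coeff β P) →
      ∃ c : ℝ, 0 < c ∧ ∀ P, fockForm (polyMap e (monomial (β + α) 1))
        (polyMap e P) = c * coeff (β + α) P by
    rw [← zero_add α]
    refine h 0 ⟨1, one_pos, fun P => ?_⟩
    have : ((monomial 0 (1 : ℝ)) : MvPolynomial (Fin k) ℝ) = 1 := rfl
    rw [this, map_one, fockForm, map_one, Module.End.one_apply, one_mul]
    induction P using MvPolynomial.induction_on with
    | C a => simp [polyMap, SymmetricAlgebra.algebraMapInv]
    | add P Q hP hQ => simp [hP, hQ]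
    | mul_X P j hP =>
      have : coeff 0 (P * X j) = 0 := by simp [coeff_mul_X']
      simp [polyMap, SymmetricAlgebra.algebraMapInv_ι, this]
  induction α using Finsupp.induction_linear with
  | zero => intro β hβ; simpa using hβ
  | add α α' h h' => intro β hβ; rw [← add_assoc]; exact h' _ (h _ hβ)
  | single i n =>
    induction n with
    | zero => intro β hβ; simpa using hβ
    | succ n ih => intro β hβ; rw [Finsupp.single_add, ← add_assoc]; exact step _ i (ih _ hβ)

theorem mem_range_polyMap (p : SymmetricAlgebra ℝ H) :
    ∃ (k : ℕ) (e : Fin k → H), Orthonormal ℝ e ∧ p ∈ (polyMap e).range := by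
  obtain ⟨s, hs⟩ : ∃ s : Finset H,
      p ∈ Algebra.adjoin ℝ (SymmetricAlgebra.ι ℝ H '' s) := by
    classical
    induction p using SymmetricAlgebra.induction with
    | algebraMap r => exact ⟨∅, Subalgebra.algebraMap_mem _ r⟩
    | ι x => exact ⟨{x}, Algebra.subset_adjoin ⟨x, by simp, rfl⟩⟩
    | mul a b ha hb =>
      obtain ⟨s, hs⟩ := ha
      obtain ⟨t, ht⟩ := hb
      exact ⟨s ∪ t, mul_mem (Algebra.adjoin_mono (Set.image_mono (by simp)) hs)
        (Algebra.adjoin_mono (Set.image_mono (by simp)) ht)⟩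
    | add a b ha hb =>
      obtain ⟨s, hs⟩ := ha
      obtain ⟨t, ht⟩ := hb
      exact ⟨s ∪ t, add_mem (Algebra.adjoin_mono (Set.image_mono (by simp)) hs)
        (Algebra.adjoin_mono (Set.image_mono (by simp)) ht)⟩
  let W := Submodule.span ℝ (s : Set H)
  let b := stdOrthonormalBasis ℝ W
  refine ⟨_, fun i => (b i : H), b.orthonormal.comp_linearIsometry W.subtypeₗᵢ, ?_⟩
  refine Algebra.adjoin_le ?_ hs
  rintro _ ⟨h, hh, rfl⟩
  have hW : h ∈ W := Submodule.subset_span hh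
  have h1 := congr((($(b.sum_repr ⟨h, hW⟩) : W) : H))
  rw [← show _ = h from h1]
  simp only [Submodule.coe_sum, map_sum, Submodule.coe_smul, map_smul]
  refine sum_mem fun i _ => Subalgebra.smul_mem _ ?_ _
  exact ⟨X i, by simp [polyMap]⟩

theorem fockForm_pos {p : SymmetricAlgebra ℝ H} (hp : p ≠ 0) : 0 < fockForm p p := by
  obtain ⟨k, e, he, P, hPp⟩ := mem_range_polyMap p
  obtain rfl : polyMap e P = p := hPp
  choose c hc hcP using fockForm_polyMap_monomial he
  have key : fockForm (polyMap e P) (polyMap e P) = ∑ α ∈ P.support, c α * coeff α P ^ 2 := by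
    have hlin : ∀ Q : MvPolynomial (Fin k) ℝ, fockForm (polyMap e Q) (polyMap e P) =
        ∑ α ∈ Q.support, c α * (coeff α Q * coeff α P) := by
      intro Q
      conv_lhs => rw [Q.as_sum]
      simp only [fockForm, map_sum, LinearMap.sum_apply]
      refine Finset.sum_congr rfl fun α _ => ?_
      have h := hcP α P
      have h2 : (monomial α (coeff α Q) : MvPolynomial (Fin k) ℝ) =
        coeff α Q • monomial α 1 := by simp [smul_monomial]
      have h3 := fockForm_smul_left (coeff α Q) (polyMap e (monomial α 1)) (polyMap e P)
      rw [← map_smul, ← h2, h] at h3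
      rw [fockForm] at h3
      rw [h3]; ring
    rw [hlin]
    exact Finset.sum_congr rfl fun α _ => by ring
  rw [key]
  have hP : P ≠ 0 := by rintro rfl; exact hp (map_zero _)
  refine Finset.sum_pos (fun α hα => ?_) (support_nonempty.2 hP)
  have := mem_support_iff.1 hα
  have := hc α
  positivity

/-- The inner product of the bosonic Fock space on `Sym H`. -/
@[reducible]
def fockCore : InnerProductSpace.Core ℝ (SymmetricAlgebra ℝ H) where
  inner := fockForm
  conj_inner_symm p q := fockForm_symm q p
  re_inner_nonneg p := by
    rcases eq_or_ne p 0 with rfl | hp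
    · simp [fockForm]
    · exact (fockForm_pos hp).le
  add_left := fockForm_add_left
  smul_left p q r := fockForm_smul_left r p q
  definite p hp := by
    by_contra h
    exact (fockForm_pos h).ne' hp

theorem annihilation_prod (f : H) {n : ℕ} (g : Fin (n + 1) → H) :
    annihilation f (∏ j, SymmetricAlgebra.ι ℝ H (g j)) =
      ∑ j, inner ℝ f (g j) • ∏ i : Fin n, SymmetricAlgebra.ι ℝ H (g (Equiv.swap 0 j i.succ)) := by
  have gen : ∀ s : Finset (Fin (n + 1)), annihilation f (∏ j ∈ s, SymmetricAlgebra.ι ℝ H (g j)) =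
      ∑ j ∈ s, inner ℝ f (g j) • ∏ i ∈ s.erase j, SymmetricAlgebra.ι ℝ H (g i) := by
    intro s
    induction s using Finset.induction_on with
    | empty => simp
    | insert a s ha ih =>
      rw [Finset.prod_insert ha, Derivation.leibniz, ih, Finset.sum_insert ha,
        Finset.erase_insert ha, annihilation_ι, smul_eq_mul, smul_eq_mul, mul_comm (∏ _ ∈ s, _),
        ← Algebra.smul_def, add_comm, Finset.mul_sum]
      congr 1
      refine Finset.sum_congr rfl fun j hj => ?_
      have hja : a ≠ j := by rintro rfl; exact ha hj
      rw [Finset.erase_insert_of_ne hja, Finset.prod_insert (by simp [ha]), mul_smul_comm]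
  rw [gen]
  refine Finset.sum_congr rfl fun j _ => ?_
  congr 1
  let F : Fin (n + 1) → SymmetricAlgebra ℝ H :=
    fun i => if i = j then 1 else SymmetricAlgebra.ι ℝ H (g i)
  have h1 : ∏ i ∈ Finset.univ.erase j, SymmetricAlgebra.ι ℝ H (g i) = ∏ i, F i := by
    rw [← Finset.mul_prod_erase Finset.univ F (Finset.mem_univ j)]
    simp only [F, if_true, one_mul]
    refine Finset.prod_congr rfl fun i hi => ?_
    rw [if_neg (Finset.ne_of_mem_erase hi)]
  rw [h1, ← Equiv.prod_comp (Equiv.swap 0 j) F, Fin.prod_univ_succ]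
  simp only [F, Equiv.swap_apply_left, if_true, one_mul]
  refine Finset.prod_congr rfl fun i _ => ?_
  rw [if_neg]
  intro h
  have := congrArg (Equiv.swap 0 j) h
  simp at this

/-- On products of `n` vectors the form is the permanent of the matrix of inner products. -/
theorem fockForm_prod {n : ℕ} (f g : Fin n → H) :
    fockForm (∏ i, SymmetricAlgebra.ι ℝ H (f i)) (∏ i, SymmetricAlgebra.ι ℝ H (g i)) =
      ∑ σ : Equiv.Perm (Fin n), ∏ i, inner ℝ (f i) (g (σ i)) := by
  induction n with
  | zero => simp [fockForm]
  | succ n ih =>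
    rw [Fin.prod_univ_succ, fockForm_ι_mul_left, annihilation_prod,
      ← Equiv.sum_comp Equiv.Perm.decomposeFin.symm, Fintype.sum_prod_type]
    have hlin : ∀ (p : SymmetricAlgebra ℝ H) (q : Fin (n + 1) → SymmetricAlgebra ℝ H),
        fockForm p (∑ j, q j) = ∑ j, fockForm p (q j) := fun p q => by simp [fockForm]
    rw [hlin]
    refine Finset.sum_congr rfl fun j _ => ?_
    rw [fockForm_smul_right, ih, Finset.mul_sum]
    refine Finset.sum_congr rfl fun σ _ => ?_
    simp [Fin.prod_univ_succ]

/-- Products of different lengths are orthogonal. -/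
theorem fockForm_prod_of_ne {m n : ℕ} (hmn : m ≠ n) (f : Fin m → H) (g : Fin n → H) :
    fockForm (∏ i, SymmetricAlgebra.ι ℝ H (f i)) (∏ i, SymmetricAlgebra.ι ℝ H (g i)) = 0 := by
  induction m generalizing n with
  | zero =>
    obtain ⟨n, rfl⟩ := Nat.exists_eq_succ_of_ne_zero hmn.symm
    simp [fockForm, Fin.prod_univ_succ, SymmetricAlgebra.algebraMapInv_ι]
  | succ m ih =>
    rw [Fin.prod_univ_succ, fockForm_ι_mul_left]
    cases n with
    | zero => simp [fockForm]
    | succ n =>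
      have hlin : ∀ (p : SymmetricAlgebra ℝ H) (q : Fin (n + 1) → SymmetricAlgebra ℝ H),
          fockForm p (∑ j, q j) = ∑ j, fockForm p (q j) := fun p q => by simp [fockForm]
      rw [annihilation_prod, hlin]
      refine Finset.sum_eq_zero fun j _ => ?_
      rw [fockForm_smul_right, ih (by omega), mul_zero]

instance : NormedAddCommGroup (SymmetricAlgebra ℝ H) :=
  (fockCore (H := H)).toNormedAddCommGroup

instance : InnerProductSpace ℝ (SymmetricAlgebra ℝ H) :=
  InnerProductSpace.ofCore (fockCore (H := H)).toCore

theorem inner_prod {n : ℕ} (f g : Fin n → H) :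
    inner ℝ (∏ i, SymmetricAlgebra.ι ℝ H (f i)) (∏ i, SymmetricAlgebra.ι ℝ H (g i)) =
      ∑ σ : Equiv.Perm (Fin n), ∏ i, inner ℝ (f i) (g (σ i)) :=
  fockForm_prod f g

/-- The Hilbert Fock space of a real Hilbert space `H`: the completion of `Sym H`. -/
abbrev FockSpace (H : Type*) [NormedAddCommGroup H] [InnerProductSpace ℝ H] : Type _ :=
  UniformSpace.Completion (SymmetricAlgebra ℝ H)

/-- The map `P(V) = Sym V → Sym H → FockSpace H` induced by a linear map `j : V → H`. -/
def toFock {V : Type*} [AddCommGroup V] [Module ℝ V] (j : V →ₗ[ℝ] H) :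
    SymmetricAlgebra ℝ V →ₗ[ℝ] FockSpace H :=
  (UniformSpace.Completion.toComplL (𝕜 := ℝ)).toLinearMap ∘ₗ
    (SymmetricAlgebra.lift (SymmetricAlgebra.ι ℝ H ∘ₗ j)).toLinearMap

end

end Fock

namespace CFT

noncomputable section
open MvPolynomial MeasureTheory Metric Laplacian
open scoped ContDiff Topology DirectSum

/-- `ℝ^d` with the Euclidean norm. -/
abbrev Space (d : ℕ) : Type := EuclideanSpace ℝ (Fin d)

/-- The open unit ball `𝔻 ⊂ ℝ^d`. -/
def disk (d : ℕ) : Set (Space d) := ball 0 1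

/-- The space `H(𝔻)` of real harmonic functions on `𝔻`: a function on `𝔻` is represented by its
extension by zero to `ℝ^d`. -/
def harmonicSubmodule (d : ℕ) : Submodule ℝ (Space d → ℝ) where
  carrier := {u | ContDiffOn ℝ ∞ u (disk d) ∧ (∀ x ∈ disk d, (Δ u : Space d → ℝ) x = 0) ∧
    ∀ x ∉ disk d, u x = 0}
  zero_mem' := ⟨contDiffOn_const,
    fun x _ => congrFun (InnerProductSpace.laplacian_const (c := (0 : ℝ))) x, fun _ _ => rfl⟩
  add_mem' := by
    rintro u v ⟨hu, hu', hu''⟩ ⟨hv, hv', hv''⟩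
    refine ⟨hu.add hv, fun x hx => ?_, fun x hx => by simp [hu'' x hx, hv'' x hx]⟩
    have hn : disk d ∈ 𝓝 x := isOpen_ball.mem_nhds hx
    have h2 : (2 : ℕ∞ω) ≤ ∞ := WithTop.coe_le_coe.2 le_top
    rw [((hu.contDiffAt hn).of_le h2).laplacian_add ((hv.contDiffAt hn).of_le h2), hu' x hx,
      hv' x hx, add_zero]
  smul_mem' := by
    rintro c u ⟨hu, hu', hu''⟩
    refine ⟨hu.const_smul c, fun x hx => ?_, fun x hx => by simp [hu'' x hx]⟩
    have hn : disk d ∈ 𝓝 x := isOpen_ball.mem_nhds hx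
    have h2 : (2 : ℕ∞ω) ≤ ∞ := WithTop.coe_le_coe.2 le_top
    rw [InnerProductSpace.laplacian_smul c ((hu.contDiffAt hn).of_le h2), hu' x hx, smul_zero]

/-- The space `H(𝔻)` of harmonic functions on the unit ball. -/
def HarmonicOnDisk (d : ℕ) : Type := harmonicSubmodule d

instance (d : ℕ) : AddCommGroup (HarmonicOnDisk d) :=
  inferInstanceAs (AddCommGroup (harmonicSubmodule d))

instance (d : ℕ) : Module ℝ (HarmonicOnDisk d) :=
  inferInstanceAs (Module ℝ (harmonicSubmodule d))

/-- The underlying function of an element of `H(𝔻)`, extended by zero to `ℝ^d`. -/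
def HarmonicOnDisk.toFun {d : ℕ} : HarmonicOnDisk d →ₗ[ℝ] (Space d → ℝ) :=
  (harmonicSubmodule d).subtype

theorem HarmonicOnDisk.contDiffAt {d : ℕ} (u : HarmonicOnDisk d) {x : Space d} (hx : x ∈ disk d)
    (m : ℕ) : ContDiffAt ℝ m u.toFun x :=
  ((show ContDiffOn ℝ ∞ u.toFun (disk d) from u.2.1).contDiffAt (isOpen_ball.mem_nhds hx)).of_le
    (by exact_mod_cast le_top)

/-- The compact subsets of `𝔻`. -/
abbrev CompactInDisk (d : ℕ) : Type := {K : Set (Space d) // IsCompact K ∧ K ⊆ disk d}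

theorem HarmonicOnDisk.bddAbove {d : ℕ} (u : HarmonicOnDisk d) (K : CompactInDisk d) (m : ℕ) :
    BddAbove (Set.range fun x : K.1 => ‖iteratedFDeriv ℝ m u.toFun x‖) := by
  have hc : ContinuousOn (fun x => ‖iteratedFDeriv ℝ m u.toFun x‖) K.1 := fun x hx =>
    (((u.contDiffAt (K.2.2 hx) m).continuousAt_iteratedFDeriv le_rfl).norm).continuousWithinAt
  have := (K.2.1.image_of_continuousOn hc).bddAbove
  rwa [Set.image_eq_range] at this

/-- The seminorms `u ↦ sup_{x ∈ K} ‖D^m u(x)‖` on `H(𝔻)`, for compact `K ⊂ 𝔻` and `m ≥ 0`. -/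
def harmonicSeminorm (d : ℕ) : SeminormFamily ℝ (HarmonicOnDisk d) (CompactInDisk d × ℕ) :=
  fun i => Seminorm.of (fun u => ⨆ x : i.1.1, ‖iteratedFDeriv ℝ i.2 u.toFun x‖)
    (fun u v => by
      refine Real.iSup_le (fun x => ?_) (add_nonneg (Real.iSup_nonneg fun _ => norm_nonneg _)
        (Real.iSup_nonneg fun _ => norm_nonneg _))
      rw [map_add, iteratedFDeriv_add_apply (u.contDiffAt (i.1.2.2 x.2) _)
        (v.contDiffAt (i.1.2.2 x.2) _)]
      exact (norm_add_le _ _).trans (add_le_add (le_ciSup (u.bddAbove i.1 i.2) x)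
        (le_ciSup (v.bddAbove i.1 i.2) x)))
    (fun c u => by
      rw [Real.mul_iSup_of_nonneg (norm_nonneg c)]
      congr 1
      ext x
      rw [map_smul, iteratedFDeriv_const_smul_apply (u.contDiffAt (i.1.2.2 x.2) _), norm_smul])

instance (d : ℕ) : Nonempty (CompactInDisk d) := ⟨⟨∅, isCompact_empty, Set.empty_subset _⟩⟩

/-- The topology of locally uniform convergence of all derivatives on `H(𝔻)`. -/
instance (d : ℕ) : TopologicalSpace (HarmonicOnDisk d) :=
  (harmonicSeminorm d).moduleFilterBasis.topology

theorem harmonicOnDisk_withSeminorms (d : ℕ) : WithSeminorms (harmonicSeminorm d) := ⟨rfl⟩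

/-- The topological dual `H'(𝔻)`. -/
abbrev HarmonicDual (d : ℕ) : Type := HarmonicOnDisk d →L[ℝ] ℝ

/-- `∑ ∂_i²` on polynomials. -/
def polyLaplacian (d : ℕ) : MvPolynomial (Fin d) ℝ →ₗ[ℝ] MvPolynomial (Fin d) ℝ :=
  ∑ i, (pderiv i).toLinearMap ∘ₗ (pderiv i).toLinearMap

/-- `Harm_{d,n}`: the harmonic homogeneous polynomials of degree `n` in `d` variables. -/
def harm (d n : ℕ) : Submodule ℝ (MvPolynomial (Fin d) ℝ) :=
  homogeneousSubmodule (Fin d) ℝ n ⊓ LinearMap.ker (polyLaplacian d)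

/-- `Harm_{d,n}` as a type. It is kept apart from the subtype because the latter inherits a topology
from the ring of polynomials. -/
def Harm (d n : ℕ) : Type := harm d n

instance (d n : ℕ) : AddCommGroup (Harm d n) := inferInstanceAs (AddCommGroup (harm d n))

instance (d n : ℕ) : Module ℝ (Harm d n) := inferInstanceAs (Module ℝ (harm d n))

/-- The polynomial underlying an element of `Harm_{d,n}`. -/
def Harm.poly {d n : ℕ} : Harm d n →ₗ[ℝ] MvPolynomial (Fin d) ℝ := (harm d n).subtype

/-- The value of a polynomial at a point of `ℝ^d`. -/
def evalAt {d : ℕ} (P : MvPolynomial (Fin d) ℝ) (x : Space d) : ℝ := eval (fun i => x i) P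

/-- `(P, Q)_{L²(S^{d-1})}`, for the rotation invariant measure of total mass one. -/
def sphereInner {d : ℕ} (P Q : MvPolynomial (Fin d) ℝ) : ℝ :=
  ⨍ ξ : sphere (0 : Space d) 1, evalAt P ξ * evalAt Q ξ ∂(volume : Measure (Space d)).toSphere

theorem contDiff_evalAt {d : ℕ} (P : MvPolynomial (Fin d) ℝ) {m : ℕ∞ω} : ContDiff ℝ m (evalAt P) := by
  unfold evalAt
  induction P using MvPolynomial.induction_on with
  | C a => simpa using contDiff_const
  | add P Q hP hQ => simpa using hP.add hQ
  | mul_X P j hP => 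
    simp only [map_mul, eval_X]
    exact hP.mul (by fun_prop)

theorem fderiv_evalAt {d : ℕ} (P : MvPolynomial (Fin d) ℝ) (x : Space d) (i : Fin d) :
    fderiv ℝ (evalAt P) x (EuclideanSpace.single i 1) = evalAt (pderiv i P) x := by
  induction P using MvPolynomial.induction_on with
  | C a =>
    have : (evalAt (C a) : Space d → ℝ) = fun _ => a := by ext; simp [evalAt]
    rw [this]; simp [evalAt]
  | add P Q hP hQ =>
    have : (evalAt (P + Q) : Space d → ℝ) = evalAt P + evalAt Q := by ext; simp [evalAt]
    rw [this, fderiv_add ((contDiff_evalAt P (m := 1)).differentiable (by simp) x)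
      ((contDiff_evalAt Q (m := 1)).differentiable (by simp) x)]
    simp [hP, hQ, evalAt]
  | mul_X P j hP =>
    have : (evalAt (P * X j) : Space d → ℝ) = evalAt P * (EuclideanSpace.proj j : Space d →L[ℝ] ℝ) := by
      ext; simp [evalAt]
    rw [this, fderiv_mul ((contDiff_evalAt P (m := 1)).differentiable (by simp) x)
      (ContinuousLinearMap.differentiableAt _)]
    rw [ContinuousLinearMap.fderiv]
    simp only [add_apply, smul_apply, hP,
      Derivation.leibniz, pderiv_X]
    simp [evalAt, Pi.single_apply]
    simp only [eq_comm (a := j)]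
    split_ifs <;> simp

theorem laplacian_evalAt {d : ℕ} (P : MvPolynomial (Fin d) ℝ) :
    Δ (evalAt P : Space d → ℝ) = evalAt (polyLaplacian d P) := by
  ext x
  rw [InnerProductSpace.laplacian_eq_iteratedFDeriv_orthonormalBasis _ (EuclideanSpace.basisFun (Fin d) ℝ)]
  simp only [iteratedFDeriv_two_apply, EuclideanSpace.basisFun_apply]
  have h : evalAt (polyLaplacian d P) x = ∑ i, evalAt (pderiv i (pderiv i P)) x := by
    simp [polyLaplacian, evalAt]
  rw [h]
  refine Finset.sum_congr rfl fun i _ => ?_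
  rw [← fderiv_evalAt, ← funext fun y => fderiv_evalAt P y i]
  rw [fderiv_clm_apply (((contDiff_evalAt P (m := 2)).fderiv_right (m := 1) (by norm_num)).differentiable (by simp) x)
    (differentiableAt_const _)]
  simp

/-- The inclusion `Harm_{d,n} ⊂ H(𝔻)` by restriction to `𝔻`. -/
def restrictDisk (d n : ℕ) : Harm d n →ₗ[ℝ] HarmonicOnDisk d where
  toFun P := ⟨(disk d).indicator (evalAt P.poly), by
    have he : ∀ x ∈ disk d, (disk d).indicator (evalAt P.poly) =ᶠ[𝓝 x] evalAt P.poly := fun x hx =>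
      Filter.eventuallyEq_of_mem (isOpen_ball.mem_nhds hx) fun y hy => Set.indicator_of_mem hy _
    refine ⟨fun x hx => (((contDiff_evalAt P.poly).contDiffAt).congr_of_eventuallyEq
      (he x hx)).contDiffWithinAt, fun x hx => ?_, fun x hx => Set.indicator_of_notMem hx _⟩
    rw [(InnerProductSpace.laplacian_congr_nhds (he x hx)).self_of_nhds, laplacian_evalAt,
      show polyLaplacian d P.poly = 0 from LinearMap.mem_ker.1 P.2.2]
    simp [evalAt]⟩
  map_add' P Q := Subtype.ext <| by
    ext x
    change _ = (disk d).indicator (evalAt P.poly) x + (disk d).indicator (evalAt Q.poly) x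
    by_cases hx : x ∈ disk d <;> simp [hx, evalAt]
  map_smul' c P := Subtype.ext <| by
    ext x
    change _ = c * (disk d).indicator (evalAt P.poly) x
    by_cases hx : x ∈ disk d <;> simp [hx, evalAt]

theorem restrictDisk_apply {d n : ℕ} (P : Harm d n) {x : Space d} (hx : x ∈ disk d) :
    (restrictDisk d n P).toFun x = evalAt P.poly x :=
  Set.indicator_of_mem hx _

theorem continuous_evalAt {d : ℕ} (P : MvPolynomial (Fin d) ℝ) :
    Continuous fun ξ : sphere (0 : Space d) 1 => evalAt P ξ :=
  (contDiff_evalAt P (m := 0)).continuous.comp continuous_subtype_val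

theorem integrable_evalAt {d : ℕ} (P Q : MvPolynomial (Fin d) ℝ) :
    Integrable (fun ξ : sphere (0 : Space d) 1 => evalAt P ξ * evalAt Q ξ)
      (volume : Measure (Space d)).toSphere :=
  ((continuous_evalAt P).mul (continuous_evalAt Q)).integrable_of_hasCompactSupport
    (HasCompactSupport.of_compactSpace _)

theorem sphereInner_add_left {d : ℕ} (P P' Q : MvPolynomial (Fin d) ℝ) :
    sphereInner (P + P') Q = sphereInner P Q + sphereInner P' Q := by
  simp only [sphereInner, average_eq]
  rw [← smul_add, ← integral_add (integrable_evalAt P Q) (integrable_evalAt P' Q)]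
  simp [evalAt, add_mul]

theorem sphereInner_smul_left {d : ℕ} (c : ℝ) (P Q : MvPolynomial (Fin d) ℝ) :
    sphereInner (c • P) Q = c * sphereInner P Q := by
  have : ∀ x : Space d, evalAt (c • P) x = c * evalAt P x := fun x => by simp [evalAt]
  simp only [sphereInner, average_eq, this, mul_assoc, integral_const_mul, smul_eq_mul]
  ring

theorem sphereInner_comm {d : ℕ} (P Q : MvPolynomial (Fin d) ℝ) :
    sphereInner P Q = sphereInner Q P := by
  simp only [sphereInner, mul_comm]

theorem sphereInner_self_nonneg {d : ℕ} (P : MvPolynomial (Fin d) ℝ) : 0 ≤ sphereInner P P := by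
  rw [sphereInner, average_eq]
  exact smul_nonneg (by positivity) (integral_nonneg fun ξ => mul_self_nonneg _)

theorem evalAt_smul {d n : ℕ} (P : Harm d n) (r : ℝ) (x : Space d) :
    evalAt P.poly (r • x) = r ^ n * evalAt P.poly x := by
  have hP : P.poly.IsHomogeneous n := P.2.1
  simp only [evalAt, eval_eq', Finset.mul_sum]
  refine Finset.sum_congr rfl fun α hα => ?_
  have hdeg : ∑ i, α i = n := by
    have := hP (mem_support_iff.1 hα)
    rw [← this, Finsupp.weight_apply, Finsupp.sum_fintype _ _ (by simp)]
    simp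
  simp only [PiLp.smul_apply, smul_eq_mul, mul_pow, Finset.prod_mul_distrib,
    Finset.prod_pow_eq_pow_sum, hdeg]
  ring

theorem eq_zero_of_sphereInner_self {d n : ℕ} (hd : d ≠ 0) (P : Harm d n)
    (h : sphereInner P.poly P.poly = 0) : P = 0 := by
  have : Nonempty (Fin d) := ⟨⟨0, Nat.pos_of_ne_zero hd⟩⟩
  have hμ : (volume : Measure (Space d)).toSphere ≠ 0 := Measure.toSphere_ne_zero _
  rw [sphereInner, average_eq, smul_eq_zero_iff_right
    (inv_ne_zero (by rw [Measure.real, ENNReal.toReal_ne_zero]; exact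
      ⟨Measure.measure_univ_ne_zero.2 hμ, measure_ne_top _ _⟩)),
    integral_eq_zero_iff_of_nonneg (fun ξ => mul_self_nonneg _) (integrable_evalAt _ _)] at h
  have h0 := (((continuous_evalAt P.poly).mul (continuous_evalAt P.poly)).ae_eq_iff_eq _
    continuous_const).1 h
  have hs : ∀ ξ : sphere (0 : Space d) 1, evalAt P.poly ξ = 0 := fun ξ =>
    mul_self_eq_zero.1 (congrFun h0 ξ)
  have hx : ∀ x : Space d, x ≠ 0 → evalAt P.poly x = 0 := fun x hx => by
    have h1 : x = ‖x‖ • (‖x‖⁻¹ • x) := by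
      rw [smul_smul, mul_inv_cancel₀ (norm_ne_zero_iff.2 hx), one_smul]
    rw [h1, evalAt_smul, hs ⟨‖x‖⁻¹ • x, by simp [norm_smul, norm_ne_zero_iff.2 hx]⟩, mul_zero]
  have hall : (evalAt P.poly : Space d → ℝ) = fun _ => 0 :=
    (contDiff_evalAt P.poly (m := 0)).continuous.ext_on (dense_compl_singleton (0 : Space d))
      continuous_const fun x hx' => hx x hx'
  refine Subtype.ext (show P.poly = 0 from MvPolynomial.funext fun y => ?_)
  simpa [evalAt] using congrFun hall (WithLp.toLp 2 y)

instance (d n : ℕ) : FiniteDimensional ℝ (Harm d n) := by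
  have : FiniteDimensional ℝ (homogeneousSubmodule (Fin d) ℝ n) :=
    Module.Finite.iff_fg.2 (homogeneousSubmodule_fg _ _ n)
  have : FiniteDimensional ℝ (harm d n) :=
    Submodule.finiteDimensional_of_le (S₂ := homogeneousSubmodule (Fin d) ℝ n) inf_le_left
  exact inferInstanceAs (FiniteDimensional ℝ (harm d n))

/-- The inner product of `Harm_{d,n}` given by the `L²(S^{d-1})` inner product. -/
@[reducible]
def harmCore (d n : ℕ) [Fact (3 ≤ d)] : InnerProductSpace.Core ℝ (Harm d n) where
  inner P Q := sphereInner P.poly Q.poly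
  conj_inner_symm P Q := sphereInner_comm Q.poly P.poly
  re_inner_nonneg P := sphereInner_self_nonneg P.poly
  add_left P Q R := sphereInner_add_left P.poly Q.poly R.poly
  smul_left P Q c := sphereInner_smul_left c P.poly Q.poly
  definite P h := eq_zero_of_sphereInner_self (by have := Fact.out (p := 3 ≤ d); omega) P h

instance (d n : ℕ) [Fact (3 ≤ d)] : NormedAddCommGroup (Harm d n) :=
  (harmCore d n).toNormedAddCommGroup

instance (d n : ℕ) [Fact (3 ≤ d)] : InnerProductSpace ℝ (Harm d n) :=
  InnerProductSpace.ofCore (harmCore d n).toCore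

instance (d n : ℕ) [Fact (3 ≤ d)] : CompleteSpace (Harm d n) :=
  FiniteDimensional.complete ℝ (Harm d n)

theorem inner_harm {d n : ℕ} [Fact (3 ≤ d)] (P Q : Harm d n) :
    inner ℝ P Q = sphereInner P.poly Q.poly := rfl

/-- `Harm_d = ⨁ₙ Harm_{d,n}`. -/
def HarmSum (d : ℕ) : Type := ⨁ n, Harm d n

instance (d : ℕ) : AddCommGroup (HarmSum d) := inferInstanceAs (AddCommGroup (⨁ n, Harm d n))

instance (d : ℕ) : Module ℝ (HarmSum d) := inferInstanceAs (Module ℝ (⨁ n, Harm d n))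

/-- The component of degree `n`. -/
def HarmSum.component {d : ℕ} (n : ℕ) : HarmSum d →ₗ[ℝ] Harm d n :=
  DirectSum.component ℝ ℕ (fun n => Harm d n) n

/-- The weight `(2n + d - 2) / (d - 2)`. -/
def cftWeight (d n : ℕ) : ℝ := (2 * (n : ℝ) + d - 2) / (d - 2)

/-- `(u, v)_CFT = ∑ₙ (2n + d - 2) / (d - 2) (uₙ, vₙ)_{L²(S^{d-1})}`, a finite sum. -/
def cftForm {d : ℕ} (u v : HarmSum d) : ℝ :=
  ∑ᶠ n, cftWeight d n * sphereInner (u.component n).poly (v.component n).poly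

theorem one_le_cftWeight (d n : ℕ) [Fact (3 ≤ d)] : 1 ≤ cftWeight d n := by
  have h : (3 : ℝ) ≤ d := by exact_mod_cast Fact.out (p := 3 ≤ d)
  rw [cftWeight, le_div_iff₀ (by linarith)]
  have : (0 : ℝ) ≤ n := n.cast_nonneg
  linarith

theorem cftForm_support {d : ℕ} (u v : HarmSum d) :
    (Function.support fun n =>
      cftWeight d n * sphereInner (u.component n).poly (v.component n).poly).Finite := by
  classical
  refine (DFinsupp.finite_support (u : Π₀ n, Harm d n)).subset fun n hn => ?_
  contrapose! hn
  have h0 : u.component n = 0 := by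
    have : (show Π₀ n, Harm d n from u) n = 0 := by simpa using hn
    exact this
  have h1 := sphereInner_smul_left 0 (0 : MvPolynomial (Fin d) ℝ) (v.component n).poly
  rw [zero_smul, zero_mul] at h1
  simp [h0, h1]

theorem cftForm_self_nonneg {d : ℕ} [Fact (3 ≤ d)] (u : HarmSum d) : 0 ≤ cftForm u u :=
  finsum_nonneg fun n => mul_nonneg (by linarith [one_le_cftWeight d n]) (sphereInner_self_nonneg _)

theorem le_cftForm_self {d : ℕ} [Fact (3 ≤ d)] (u : HarmSum d) (n : ℕ) :
    sphereInner (u.component n).poly (u.component n).poly ≤ cftForm u u := by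
  have h1 := sphereInner_self_nonneg (u.component n).poly
  calc sphereInner (u.component n).poly (u.component n).poly
      ≤ cftWeight d n * sphereInner (u.component n).poly (u.component n).poly :=
        le_mul_of_one_le_left h1 (one_le_cftWeight d n)
    _ ≤ cftForm u u := single_le_finsum n (cftForm_support u u) fun m =>
        mul_nonneg (by linarith [one_le_cftWeight d m]) (sphereInner_self_nonneg _)

/-- The inner product `(·, ·)_CFT` of `Harm_d`. -/
@[reducible]
def cftCore (d : ℕ) [Fact (3 ≤ d)] : InnerProductSpace.Core ℝ (HarmSum d) where
  inner := cftForm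
  conj_inner_symm u v := by simp only [cftForm, sphereInner_comm, conj_trivial]
  re_inner_nonneg u := cftForm_self_nonneg u
  add_left u v w := by
    simp only [cftForm]
    rw [← finsum_add_distrib (cftForm_support u w) (cftForm_support v w)]
    simp only [map_add, sphereInner_add_left, mul_add]
  smul_left u v c := by
    simp only [cftForm, map_smul, sphereInner_smul_left, conj_trivial]
    rw [mul_finsum]
    simp only [mul_left_comm]
  definite u h := by
    refine DFinsupp.ext fun n => ?_
    refine eq_zero_of_sphereInner_self (by have := Fact.out (p := 3 ≤ d); omega) _ ?_
    exact le_antisymm ((le_cftForm_self u n).trans h.le) (sphereInner_self_nonneg _)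

instance (d : ℕ) [Fact (3 ≤ d)] : NormedAddCommGroup (HarmSum d) :=
  (cftCore d).toNormedAddCommGroup

instance (d : ℕ) [Fact (3 ≤ d)] : InnerProductSpace ℝ (HarmSum d) :=
  InnerProductSpace.ofCore (cftCore d).toCore

theorem inner_harmSum {d : ℕ} [Fact (3 ≤ d)] (u v : HarmSum d) :
    inner ℝ u v = cftForm u v := rfl

/-- The Hilbert space `H_CFT`, the completion of `Harm_d` for `(·, ·)_CFT`. -/
abbrev HCFT (d : ℕ) [Fact (3 ≤ d)] : Type := UniformSpace.Completion (HarmSum d)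

/-- The degree `n` component is continuous on `Harm_d`. -/
def componentL (d : ℕ) [Fact (3 ≤ d)] (n : ℕ) : HarmSum d →L[ℝ] Harm d n :=
  LinearMap.mkContinuous (HarmSum.component n) 1 fun u => by
    rw [one_mul]
    refine abs_le_of_sq_le_sq' ?_ (norm_nonneg u) |>.2
    rw [← real_inner_self_eq_norm_sq, ← real_inner_self_eq_norm_sq]
    exact le_cftForm_self u n

/-- The map `H_CFT → ∏ₙ Harm_{d,n}`: in each degree, the continuous extension of the component
map of `Harm_d`. -/
def cftExpansion (d : ℕ) [Fact (3 ≤ d)] : HCFT d →ₗ[ℝ] ((n : ℕ) → Harm d n) :=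
  LinearMap.pi fun n =>
    ((componentL d n).extend (UniformSpace.Completion.toComplL (𝕜 := ℝ))).toLinearMap

theorem cftExpansion_coe {d : ℕ} [Fact (3 ≤ d)] (u : HarmSum d) (n : ℕ) :
    cftExpansion d (u : HCFT d) n = u.component n :=
  ContinuousLinearMap.extend_eq (componentL d n) UniformSpace.Completion.denseRange_coe
    (UniformSpace.Completion.isUniformInducing_coe _) u

/-- The map `H'(𝔻) → ∏ₙ Harm_{d,n}`, `T ↦ (tₙ)ₙ`, where `tₙ` is the unique element of `Harm_{d,n}`
with `(tₙ, u)_{L²(S^{d-1})} = T(u)` for all `u ∈ Harm_{d,n}`. -/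
def dualExpansion (d : ℕ) [Fact (3 ≤ d)] : HarmonicDual d →ₗ[ℝ] ((n : ℕ) → Harm d n) :=
  LinearMap.pi fun n =>
    { toFun := fun T => (InnerProductSpace.toDual ℝ (Harm d n)).symm
        (LinearMap.toContinuousLinearMap (T.toLinearMap ∘ₗ restrictDisk d n))
      map_add' := fun T S => by rw [← map_add]; rfl
      map_smul' := fun c T => by
        rw [RingHom.id_apply, ← map_smul]; rfl }

theorem dualExpansion_spec {d : ℕ} [Fact (3 ≤ d)] (T : HarmonicDual d) (n : ℕ) (u : Harm d n) :
    sphereInner (dualExpansion d T n).poly u.poly = T (restrictDisk d n u) :=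
  InnerProductSpace.toDual_symm_apply (x := u)

end

end CFT

/-! ### Functoriality of the Fock space: injectivity and density of `toFock j`. -/

namespace Fock

noncomputable section

variable {H : Type*} [NormedAddCommGroup H] [InnerProductSpace ℝ H]

/-! The inclusion of `H'(𝔻)` in `H_CFT` comes from geometric decay. By interior estimates, every
derivative seminorm on `H(𝔻)` is controlled by a sup norm on some closed ball of radius `r < 1`, so
a functional `T` satisfies `|T u| ≤ C sup_{|x| ≤ r} |u|` for some such `r`
(`HarmonicDual.exists_bound`). Testing `T` on its own component `tₙ` gives `‖tₙ‖² = T(tₙ) ≤ C rⁿ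
sup_{|ξ| = 1} |tₙ|`. On `Harm_{d,n}` the sup norm on the sphere exceeds the `L²` norm by at most a
factor polynomial in `n` (`abs_evalAt_le_norm`). Hence `‖tₙ‖` is at most a polynomial in `n` times
`rⁿ`, which beats the linearly growing weight of the CFT norm, and `∑ tₙ` converges absolutely in
`H_CFT`.

The expansion of `H'(𝔻)` is injective because harmonic polynomials are dense in `H(𝔻)`: approximate
`u` by a polynomial on a ball, replace it by the harmonic polynomial with the same values on the
bounding sphere, and apply the maximum principle (`HarmonicDual.eq_zero`). The expansion of `H_CFT`
is injective because an element with zero components is orthogonal to the dense subspace `Harm_d`.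
The image of `H'(𝔻)` is dense because it contains each `Harm_{d,n}`, realized by functionals of the
`n`-jet at the origin (`exists_dualExpansion_eq`).

Passing to Fock spaces is formal. A linear left inverse of the inclusion, continuous or not, induces
a left inverse on symmetric algebras, and density passes to products because `f₁ ⋯ fₙ` depends
continuously on its factors.

The harmonic function theory rests on the weak maximum principle `nonpos_of_laplacian_nonneg`;
neither the Poisson kernel nor the mean value property enters. -/

/-- The squared norm is a permanent, a sum of `n!` products, and Cauchy–Schwarz bounds each of them
by `∏ ‖f i‖²`. This makes the product map a bounded multilinear map. -/
theorem norm_prod_ι_le {n : ℕ} (f : Fin n → H) :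
    ‖∏ i, SymmetricAlgebra.ι ℝ H (f i)‖ ≤ √(n.factorial) * ∏ i, ‖f i‖ := by
  refine abs_le_of_sq_le_sq' ?_ (by positivity) |>.2
  rw [← real_inner_self_eq_norm_sq, inner_prod, mul_pow, Real.sq_sqrt (by positivity)]
  calc ∑ σ : Equiv.Perm (Fin n), ∏ i, inner ℝ (f i) (f (σ i))
      ≤ ∑ _σ : Equiv.Perm (Fin n), (∏ i, ‖f i‖) ^ 2 := by
        refine Finset.sum_le_sum fun σ _ => (le_abs_self _).trans ?_
        rw [Finset.abs_prod]
        calc ∏ i, |inner ℝ (f i) (f (σ i))| ≤ ∏ i, ‖f i‖ * ‖f (σ i)‖ :=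
              Finset.prod_le_prod (fun _ _ => abs_nonneg _) fun i _ => abs_real_inner_le_norm _ _
          _ = (∏ i, ‖f i‖) ^ 2 := by
              rw [Finset.prod_mul_distrib, Equiv.prod_comp σ fun i => ‖f i‖, sq]
    _ = n.factorial * (∏ i, ‖f i‖) ^ 2 := by
        simp [Fintype.card_perm]

theorem continuous_prod_ι (n : ℕ) :
    Continuous fun f : Fin n → H => ∏ i, SymmetricAlgebra.ι ℝ H (f i) :=
  (((MultilinearMap.mkPiAlgebra ℝ (Fin n) (SymmetricAlgebra ℝ H)).compLinearMap
    fun _ => SymmetricAlgebra.ι ℝ H).mkContinuous _ norm_prod_ι_le).cont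

theorem span_range_prod_ι :
    Submodule.span ℝ (⋃ n, Set.range fun f : Fin n → H => ∏ i, SymmetricAlgebra.ι ℝ H (f i)) =
      ⊤ := by
  refine Submodule.eq_top_iff'.2 fun p => ?_
  induction p using induction_ι_mul with
  | one => exact Submodule.subset_span (Set.mem_iUnion.2 ⟨0, ![], by simp⟩)
  | add p q hp hq => exact add_mem hp hq
  | smul c p hp => exact Submodule.smul_mem _ c hp
  | mul f p hp =>
    induction hp using Submodule.span_induction with
    | mem p hp =>
      obtain ⟨n, g, rfl⟩ := Set.mem_iUnion.1 hp
      exact Submodule.subset_span (Set.mem_iUnion.2 ⟨n + 1, Fin.cons f g,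
        by simp [Fin.prod_univ_succ]⟩)
    | zero => simp
    | add p q _ _ hp hq => rw [mul_add]; exact add_mem hp hq
    | smul c p _ hp => rw [mul_smul_comm]; exact Submodule.smul_mem _ c hp

/-- Over a field `j` has a linear left inverse `g`, and `Sym g` is then a left inverse of `Sym j`;
no continuity of `g` is needed. The remaining map into the completion is injective because the Fock
form is definite. -/
theorem toFock_injective {V : Type*} [AddCommGroup V] [Module ℝ V] {j : V →ₗ[ℝ] H}
    (hj : Function.Injective j) : Function.Injective (toFock j) := by
  obtain ⟨g, hg⟩ := j.exists_leftInverse_of_injective (LinearMap.ker_eq_bot.2 hj)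
  refine (UniformSpace.Completion.coe_injective _).comp ?_
  refine Function.LeftInverse.injective
    (g := SymmetricAlgebra.lift (SymmetricAlgebra.ι ℝ V ∘ₗ g)) fun p => ?_
  have : (SymmetricAlgebra.lift (SymmetricAlgebra.ι ℝ V ∘ₗ g)).comp
      (SymmetricAlgebra.lift (SymmetricAlgebra.ι ℝ H ∘ₗ j)) = AlgHom.id ℝ _ := by
    apply SymmetricAlgebra.algHom_ext
    ext v
    simp [show g (j v) = v from congr($hg v)]
  exact congr($this p)

/-- The closure of the range of `Sym j` is a subspace, so it is enough that it contains every
product `f₁ ⋯ fₙ`; approximate the factors one by one within the range of `j`. -/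
theorem toFock_denseRange {V : Type*} [AddCommGroup V] [Module ℝ V] {j : V →ₗ[ℝ] H}
    (hj : DenseRange j) : DenseRange (toFock j) := by
  refine (UniformSpace.Completion.denseRange_coe (α := SymmetricAlgebra ℝ H)).comp
    (f := SymmetricAlgebra.lift (SymmetricAlgebra.ι ℝ H ∘ₗ j)) ?_
    (UniformSpace.Completion.continuous_coe _)
  set A := LinearMap.range (SymmetricAlgebra.lift (SymmetricAlgebra.ι ℝ H ∘ₗ j)).toLinearMap
  suffices h : A.topologicalClosure = ⊤ from Submodule.dense_iff_topologicalClosure_eq_top.2 h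
  rw [← top_le_iff, ← span_range_prod_ι, Submodule.span_le]
  refine Set.iUnion_subset fun n => ?_
  rintro _ ⟨f, rfl⟩
  have hd : DenseRange (Pi.map fun _ : Fin n => (j : V → H)) := DenseRange.piMap fun _ => hj
  refine map_mem_closure (f := fun f : Fin n → H => ∏ i, SymmetricAlgebra.ι ℝ H (f i))
    (continuous_prod_ι n) (hd f) ?_
  rintro _ ⟨v, rfl⟩
  exact ⟨∏ i, SymmetricAlgebra.ι ℝ V (v i), by simp [map_prod]⟩

end

end Fock

namespace CFT

noncomputable section
open MvPolynomial MeasureTheory Metric Laplacian InnerProductSpace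
open scoped ContDiff Topology DirectSum

/-! ### The weak maximum principle. -/

theorem iteratedFDeriv_two_nonpos_of_isLocalMax {E : Type*} [NormedAddCommGroup E]
    [NormedSpace ℝ E] {f : E → ℝ} {x : E} (hf : ContDiffAt ℝ 2 f x) (h : IsLocalMax f x) (v : E) :
    iteratedFDeriv ℝ 2 f x ![v, v] ≤ 0 := by
  by_contra! hpos
  have hline : ∀ t : ℝ, HasDerivAt (fun t : ℝ => x + t • v) v t := fun t => by
    simpa using ((hasDerivAt_id t).smul_const v).const_add x
  have hcont : Filter.Tendsto (fun t : ℝ => x + t • v) (𝓝 0) (𝓝 x) := by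
    simpa using (hline 0).continuousAt.tendsto
  have hx : x + (0 : ℝ) • v = x := by simp
  have hg : ∀ g : E → E →L[ℝ] ℝ, DifferentiableAt ℝ g x →
      HasDerivAt (fun t : ℝ => g (x + t • v) v) (fderiv ℝ g x v v) 0 := fun g hg => by
    have h1 : HasFDerivAt g (fderiv ℝ g x) (x + (0 : ℝ) • v) := by rw [hx]; exact hg.hasFDerivAt
    have h2 : HasDerivAt (fun t : ℝ => g (x + t • v)) (fderiv ℝ g x v) 0 :=
      h1.comp_hasDerivAt (0 : ℝ) (hline 0)
    simpa using h2.clm_apply (hasDerivAt_const (0 : ℝ) v)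
  have hd : deriv (fun t : ℝ => f (x + t • v)) =ᶠ[𝓝 0] fun t => fderiv ℝ f (x + t • v) v := by
    have : ∀ᶠ y in 𝓝 x, DifferentiableAt ℝ f y := by
      filter_upwards [hf.eventually (by simp)] with y hy
      exact hy.differentiableAt (by simp)
    filter_upwards [hcont.eventually this] with t ht
    exact (ht.hasFDerivAt.comp_hasDerivAt t (hline t)).deriv
  have hdd : deriv (deriv fun t : ℝ => f (x + t • v)) 0 = iteratedFDeriv ℝ 2 f x ![v, v] := by
    rw [hd.deriv_eq, iteratedFDeriv_two_apply]
    exact (hg _ ((hf.fderiv_right (m := 1) (by norm_num)).differentiableAt (by simp))).deriv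
  have hmax : IsLocalMax (fun t : ℝ => f (x + t • v)) 0 := by
    have := hcont.eventually h
    simpa [IsLocalMax, IsMaxFilter] using this
  have hc : ContinuousAt (fun t : ℝ => f (x + t • v)) 0 := by
    have : ContinuousAt f (x + (0 : ℝ) • v) := by rw [hx]; exact hf.continuousAt
    exact this.comp (f := fun t : ℝ => x + t • v) (hline 0).continuousAt
  have hmin := isLocalMin_of_deriv_deriv_pos (by rw [hdd]; exact hpos) hmax.deriv_eq_zero hc
  -- A positive second derivative would make the local maximum a local minimum as well, so the
  -- function would be locally constant on the line and its second derivative zero.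
  have heq : (fun t : ℝ => f (x + t • v)) =ᶠ[𝓝 0] fun _ => f (x + (0 : ℝ) • v) := by
    filter_upwards [hmax, hmin] with t h1 h2 using le_antisymm h1 h2
  have : deriv (deriv fun t : ℝ => f (x + t • v)) 0 = 0 := by
    rw [heq.deriv.deriv_eq]; simp
  rw [hdd] at this
  exact hpos.ne' this

variable {d : ℕ}

theorem evalAt_sum_X_sq (x : Space d) : evalAt (∑ i, X i ^ 2) x = ‖x‖ ^ 2 := by
  simp [evalAt, EuclideanSpace.norm_sq_eq]

theorem polyLaplacian_X (i : Fin d) : polyLaplacian d (X i) = 0 := by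
  classical
  simp only [polyLaplacian, LinearMap.sum_apply, LinearMap.comp_apply, Derivation.coeFn_coe]
  refine Finset.sum_eq_zero fun j _ => ?_
  rw [pderiv_X]
  by_cases h : i = j
  · subst h; simp
  · simp [h]

theorem polyLaplacian_X_sq (i : Fin d) : polyLaplacian d (X i ^ 2) = 2 := by
  classical
  simp only [polyLaplacian, LinearMap.sum_apply, LinearMap.comp_apply, Derivation.coeFn_coe]
  rw [Finset.sum_eq_single i]
  · simp [pow_two]; norm_num
  · intro j _ hj
    simp [pderiv_X, hj]
  · simp

theorem polyLaplacian_sum_X_sq : polyLaplacian d (∑ i, X i ^ 2) = C (2 * d : ℝ) := by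
  rw [map_sum, Finset.sum_congr rfl fun i _ => polyLaplacian_X_sq i]
  simp [mul_comm, show (C 2 : MvPolynomial (Fin d) ℝ) = 2 from rfl]

/-- The weak maximum principle for subharmonic functions. -/
theorem nonpos_of_laplacian_nonneg (hd : d ≠ 0) {K : Set (Space d)} (hK : IsCompact K)
    {f : Space d → ℝ} (hf : ContinuousOn f K)
    (h : ∀ y ∈ K, f y ≤ 0 ∨ K ∈ 𝓝 y ∧ ContDiffAt ℝ 2 f y ∧ 0 ≤ Δ f y) {z : Space d} (hz : z ∈ K) :
    f z ≤ 0 := by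
  obtain ⟨R, hR⟩ := hK.isBounded.exists_norm_le
  suffices key : ∀ ε : ℝ, 0 < ε → f z ≤ ε * R ^ 2 by
    have ht : Filter.Tendsto (fun ε : ℝ => ε * R ^ 2) (𝓝[>] 0) (𝓝 0) := by
      have : Continuous fun ε : ℝ => ε * R ^ 2 := by fun_prop
      simpa using (this.tendsto 0).mono_left nhdsWithin_le_nhds
    exact ge_of_tendsto ht (Filter.eventually_of_mem self_mem_nhdsWithin key)
  intro ε hε
  -- Adding `ε‖y‖²` makes the Laplacian at least `2dε > 0` wherever `Δ f ≥ 0`, which excludes a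
  -- maximum there; the perturbation is at most `ε R²` on `K`.
  let P : MvPolynomial (Fin d) ℝ := ε • ∑ i, X i ^ 2
  have hP : ∀ y, evalAt P y = ε * ‖y‖ ^ 2 := fun y => by
    rw [← evalAt_sum_X_sq]; simp [P, evalAt]
  have hPc : ∀ {m : ℕ∞ω}, ContDiff ℝ m (evalAt P) := contDiff_evalAt P
  obtain ⟨y, hy, hmax⟩ := hK.exists_isMaxOn ⟨z, hz⟩ (hf.add (hPc (m := 0)).continuous.continuousOn)
  have hle : f z ≤ f y + ε * ‖y‖ ^ 2 := by
    have h1 := hmax hz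
    simp only [Set.mem_ofPred_eq, Pi.add_apply, hP] at h1
    nlinarith [sq_nonneg ‖z‖]
  have hRy : ε * ‖y‖ ^ 2 ≤ ε * R ^ 2 := by
    have := hR y hy
    gcongr
  rcases h y hy with h0 | ⟨hn, hc, hΔ⟩
  · linarith
  · exfalso
    have hloc : IsLocalMax (f + evalAt P) y := hmax.isLocalMax hn
    have hsum : Δ (f + evalAt P) y ≤ 0 := by
      rw [laplacian_eq_iteratedFDeriv_stdOrthonormalBasis]
      exact Finset.sum_nonpos fun i _ =>
        iteratedFDeriv_two_nonpos_of_isLocalMax (hc.add hPc.contDiffAt) hloc _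
    rw [hc.laplacian_add hPc.contDiffAt, laplacian_evalAt] at hsum
    have h2 : evalAt (polyLaplacian d P) y = ε * (2 * d) := by
      simp only [P, map_smul, polyLaplacian_sum_X_sq]
      simp [evalAt]
    have : (0 : ℝ) < d := by exact_mod_cast Nat.pos_of_ne_zero hd
    rw [h2] at hsum
    have : 0 < ε * (2 * d) := by positivity
    linarith

/-! ### Interior estimates for derivatives of harmonic functions. -/

theorem harmonicAt_evalAt {P : MvPolynomial (Fin d) ℝ} (hP : polyLaplacian d P = 0)
    (x : Space d) : HarmonicAt (evalAt P) x :=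
  ⟨(contDiff_evalAt P).contDiffAt, Filter.Eventually.of_forall fun y => by
    rw [laplacian_evalAt, hP]; simp [evalAt]⟩

/-- The Laplacian may be computed in any orthonormal basis: use a basis `b` on the left and its
image `R b` on the right. -/
theorem laplacian_comp_linearIsometryEquiv {E F : Type*} [NormedAddCommGroup E]
    [InnerProductSpace ℝ E] [FiniteDimensional ℝ E] [NormedAddCommGroup F] [NormedSpace ℝ F]
    (R : E ≃ₗᵢ[ℝ] E) (f : E → F) (x : E) : Δ (f ∘ R) x = Δ f (R x) := by
  rw [laplacian_eq_iteratedFDeriv_orthonormalBasis _ (stdOrthonormalBasis ℝ E),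
    laplacian_eq_iteratedFDeriv_orthonormalBasis _ ((stdOrthonormalBasis ℝ E).map R)]
  refine Finset.sum_congr rfl fun i _ => ?_
  have h := R.toContinuousLinearEquiv.iteratedFDerivWithin_comp_right f uniqueDiffOn_univ
    (x := x) (Set.mem_univ _) 2
  simp only [Set.preimage_univ, iteratedFDerivWithin_univ] at h
  have h2 := congr($h ![stdOrthonormalBasis ℝ E i, stdOrthonormalBasis ℝ E i])
  refine h2.trans ?_
  rw [ContinuousMultilinearMap.compContinuousLinearMap_apply]
  congr 1
  ext j
  fin_cases j <;> rfl

theorem harmonicAt_comp_linearIsometryEquiv {E F : Type*} [NormedAddCommGroup E]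
    [InnerProductSpace ℝ E] [FiniteDimensional ℝ E] [NormedAddCommGroup F] [NormedSpace ℝ F]
    (R : E ≃ₗᵢ[ℝ] E) {f : E → F} {x : E} (h : HarmonicAt f (R x)) : HarmonicAt (f ∘ R) x := by
  refine ⟨h.1.comp x R.contDiff.contDiffAt, ?_⟩
  filter_upwards [R.continuous.continuousAt.eventually h.2] with y hy
  rw [laplacian_comp_linearIsometryEquiv, hy]; rfl

theorem harmonicAt_comp_add_left {E F : Type*} [NormedAddCommGroup E]
    [InnerProductSpace ℝ E] [FiniteDimensional ℝ E] [NormedAddCommGroup F] [NormedSpace ℝ F]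
    {f : E → F} {a x : E} (h : HarmonicAt f (a + x)) : HarmonicAt (fun y => f (a + y)) x := by
  refine ⟨h.1.comp x (contDiff_const.add contDiff_id).contDiffAt, ?_⟩
  have : ContinuousAt (fun y => a + y) x := by fun_prop
  filter_upwards [this.eventually h.2] with y hy
  rw [laplacian_eq_iteratedFDeriv_stdOrthonormalBasis] at hy ⊢
  simp only [iteratedFDeriv_comp_add_left]
  exact hy

/-- Comparison of the odd part of a harmonic function with a harmonic quadratic polynomial on a half
ball. -/
theorem sub_reflection_le {u : Space d → ℝ} {ρ M : ℝ} (hρ : 0 < ρ)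
    (hu : HarmonicOnNhd u (closedBall 0 ρ)) (hM : ∀ y ∈ closedBall 0 ρ, |u y| ≤ M) (i : Fin d)
    {t : ℝ} (ht : 0 < t) (htρ : t < ρ) :
    u (t • EuclideanSpace.single i 1) - u (-(t • EuclideanSpace.single i 1)) ≤
      2 * M * (d / ρ * t) := by
  have hd : d ≠ 0 := (Fin.pos i).ne'
  have hM0 : 0 ≤ M := (abs_nonneg _).trans (hM 0 (by simp [hρ.le]))
  set e : Space d := EuclideanSpace.single i 1 with he
  have hei : ∀ y : Space d, inner ℝ e y = y i := fun y => by
    rw [he, EuclideanSpace.inner_single_left]; simp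
  let R : Space d ≃ₗᵢ[ℝ] Space d := (ℝ ∙ e)ᗮ.reflection
  have hRe : R e = -e := Submodule.reflection_orthogonalComplement_singleton_eq_neg e
  have hR0 : ∀ y : Space d, y i = 0 → R y = y := fun y hy =>
    Submodule.reflection_mem_subspace_eq_self
      (Submodule.mem_orthogonal_singleton_iff_inner_right.2 (by rw [hei, hy]))
  -- The barrier `P` is harmonic and dominates `u - u ∘ R` on the boundary of the half ball: on the
  -- flat face `y i = 0` the difference vanishes and `P ≥ 0`; on the round part `P = 2M + (2Md/ρ²) y
  -- i (ρ - y i) ≥ 2M`. On the axis `P(t e) ≤ 2M d t / ρ` because `d ≥ 1`.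
  let P : MvPolynomial (Fin d) ℝ := (2 * M / ρ ^ 2) • (∑ j, X j ^ 2) +
    (2 * M * d / ρ) • X i - (2 * M * d / ρ ^ 2) • X i ^ 2
  have hPe : ∀ y : Space d, evalAt P y =
      2 * M / ρ ^ 2 * ‖y‖ ^ 2 + 2 * M * d / ρ * y i - 2 * M * d / ρ ^ 2 * y i ^ 2 := fun y => by
    rw [← evalAt_sum_X_sq]; simp [P, evalAt]
  have hPΔ : polyLaplacian d P = 0 := by
    simp only [P, map_sub, map_add, map_smul, polyLaplacian_sum_X_sq, polyLaplacian_X,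
      polyLaplacian_X_sq]
    rw [show (2 : MvPolynomial (Fin d) ℝ) = C 2 from rfl]
    simp only [smul_zero, add_zero, smul_eq_C_mul, ← C_mul, ← C_sub]
    rw [C_eq_zero]; ring
  let K : Set (Space d) := closedBall 0 ρ ∩ {y | 0 ≤ y i}
  have hic : Continuous fun y : Space d => y i := by fun_prop
  have hK : IsCompact K := (isCompact_closedBall _ _).inter_right (isClosed_le continuous_const hic)
  have hRK : ∀ y ∈ closedBall (0 : Space d) ρ, R y ∈ closedBall 0 ρ := fun y hy => by
    simpa using hy
  have hH : ∀ y ∈ closedBall (0 : Space d) ρ, HarmonicAt (u - u ∘ R - evalAt P) y := fun y hy =>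
    ((hu y hy).sub (harmonicAt_comp_linearIsometryEquiv R (hu _ (hRK y hy)))).sub
      (harmonicAt_evalAt hPΔ y)
  have hmain : (u - u ∘ R - evalAt P) (t • e) ≤ 0 := by
    refine nonpos_of_laplacian_nonneg hd hK
      (fun y hy => (hH y hy.1).1.continuousAt.continuousWithinAt) (fun y hy => ?_)
      ⟨by simp [he, norm_smul, abs_of_pos ht, htρ.le], by simp [he, ht.le]⟩
    have hyi : 0 ≤ y i := hy.2
    have hyn : ‖y‖ ≤ ρ := by simpa using hy.1
    have hyin : y i ≤ ‖y‖ := (le_abs_self _).trans (by simpa using PiLp.norm_apply_le y i)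
    rcases hyi.eq_or_lt with h0 | h0
    · left
      simp only [Pi.sub_apply, Function.comp_apply, hR0 y h0.symm, hPe, ← h0]
      have : 0 ≤ 2 * M / ρ ^ 2 * ‖y‖ ^ 2 := by positivity
      linarith
    rcases hyn.eq_or_lt with h1 | h1
    · left
      simp only [Pi.sub_apply, Function.comp_apply, hPe, h1]
      have h2 := abs_le.1 (hM y hy.1)
      have h3 := abs_le.1 (hM _ (hRK y hy.1))
      have h4 : 2 * M / ρ ^ 2 * ρ ^ 2 = 2 * M := by field_simp
      have h5 : 0 ≤ 2 * M * d / ρ * y i - 2 * M * d / ρ ^ 2 * y i ^ 2 := by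
        have : 2 * M * d / ρ * y i - 2 * M * d / ρ ^ 2 * y i ^ 2 =
          2 * M * d / ρ ^ 2 * (y i * (ρ - y i)) := by field_simp
        rw [this]
        have : 0 ≤ ρ - y i := by linarith
        positivity
      linarith [h2.2, h3.1]
    · right
      refine ⟨Filter.inter_mem (closedBall_mem_nhds_of_mem (by simpa using h1))
        (Filter.mem_of_superset ((isOpen_lt continuous_const hic).mem_nhds h0)
          fun z hz => show 0 ≤ z i from le_of_lt hz), (hH y hy.1).1, (hH y hy.1).2.self_of_nhds.ge⟩
  simp only [Pi.sub_apply, Function.comp_apply, hPe, map_smul, hRe, smul_neg] at hmain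
  have h1 : ‖t • e‖ = t := by simp [he, norm_smul, abs_of_pos ht]
  have h2 : (t • e) i = t := by simp [he]
  rw [h1, h2] at hmain
  have h3 : (1 : ℝ) ≤ d := by exact_mod_cast Nat.pos_of_ne_zero hd
  have h4 : 2 * M / ρ ^ 2 * t ^ 2 ≤ 2 * M * d / ρ ^ 2 * t ^ 2 := by
    have : 2 * M ≤ 2 * M * d := by nlinarith
    gcongr
  have h5 : 2 * M * d / ρ * t = 2 * M * (d / ρ * t) := by ring
  linarith

/-- Divide `sub_reflection_le` by `t` and let `t → 0⁺`: the left side tends to twice the partial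
derivative. -/
theorem fderiv_single_le {u : Space d → ℝ} {ρ M : ℝ} (hρ : 0 < ρ)
    (hu : HarmonicOnNhd u (closedBall 0 ρ)) (hM : ∀ y ∈ closedBall 0 ρ, |u y| ≤ M) (i : Fin d) :
    fderiv ℝ u 0 (EuclideanSpace.single i 1) ≤ d / ρ * M := by
  set e : Space d := EuclideanSpace.single i 1
  have hd0 : HasFDerivAt u (fderiv ℝ u 0) 0 :=
    ((hu 0 (by simp [hρ.le])).1.differentiableAt (by simp)).hasFDerivAt
  have hl : HasDerivAt (fun t : ℝ => t • e) e 0 := by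
    simpa using (hasDerivAt_id (0 : ℝ)).smul_const e
  have h1 : HasDerivAt (fun t : ℝ => u (t • e)) (fderiv ℝ u 0 e) 0 :=
    HasFDerivAt.comp_hasDerivAt (0 : ℝ) (by simpa using hd0) hl
  have h2 : HasDerivAt (fun t : ℝ => u (-(t • e))) (fderiv ℝ u 0 (-e)) 0 :=
    HasFDerivAt.comp_hasDerivAt (0 : ℝ) (by simpa using hd0) hl.neg
  have h3 := (h1.sub h2).tendsto_slope_zero_right
  have h4 : fderiv ℝ u 0 e - fderiv ℝ u 0 (-e) ≤ 2 * M * (d / ρ) := by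
    refine le_of_tendsto h3 ?_
    filter_upwards [Ioo_mem_nhdsGT hρ] with t ht
    have := sub_reflection_le hρ hu hM i ht.1 ht.2
    simp only [zero_add, Pi.sub_apply, zero_smul, neg_zero, sub_self, sub_zero, smul_eq_mul]
    rw [inv_mul_le_iff₀ ht.1]
    linarith
  rw [map_neg] at h4
  linarith

/-- One factor `d` comes from the bound on each partial derivative, applied to `u` and `-u` after a
translation; the other from summing over the `d` coordinates of a vector. -/
theorem norm_fderiv_le_of_harmonic_real {u : Space d → ℝ} {x : Space d} {ρ M : ℝ} (hρ : 0 < ρ)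
    (hu : HarmonicOnNhd u (closedBall x ρ)) (hM : ∀ y ∈ closedBall x ρ, |u y| ≤ M) :
    ‖fderiv ℝ u x‖ ≤ d ^ 2 / ρ * M := by
  have hM0 : 0 ≤ M := (abs_nonneg _).trans (hM x (by simp [hρ.le]))
  have hmem : ∀ y ∈ closedBall (0 : Space d) ρ, x + y ∈ closedBall x ρ := fun y hy => by
    simpa using hy
  have hv : HarmonicOnNhd (fun y => u (x + y)) (closedBall 0 ρ) := fun y hy =>
    harmonicAt_comp_add_left (hu _ (hmem y hy))
  have hfd : fderiv ℝ (fun y => u (x + y)) 0 = fderiv ℝ u x := by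
    rw [fderiv_comp_add_left, add_zero]
  have hi : ∀ i, |fderiv ℝ u x (EuclideanSpace.single i 1)| ≤ d / ρ * M := fun i => by
    refine abs_le'.2 ⟨?_, ?_⟩
    · rw [← hfd]; exact fderiv_single_le hρ hv (fun y hy => hM _ (hmem y hy)) i
    · have := fderiv_single_le hρ hv.neg (M := M) (fun y hy => by
        simpa using hM _ (hmem y hy)) i
      rw [fderiv_neg, hfd] at this
      simpa using this
  refine ContinuousLinearMap.opNorm_le_bound _ (by positivity) fun v => ?_
  have hsum : v = ∑ i, v i • EuclideanSpace.single i (1 : ℝ) := by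
    simpa using ((EuclideanSpace.basisFun (Fin d) ℝ).sum_repr v).symm
  conv_lhs => rw [hsum]
  rw [map_sum]
  calc ‖∑ i, fderiv ℝ u x (v i • EuclideanSpace.single i (1 : ℝ))‖
      ≤ ∑ _i : Fin d, ‖v‖ * (d / ρ * M) := by
        refine norm_sum_le_of_le _ fun i _ => ?_
        rw [map_smul, norm_smul]
        exact mul_le_mul (PiLp.norm_apply_le v i) (hi i) (norm_nonneg _) (norm_nonneg _)
    _ = d ^ 2 / ρ * M * ‖v‖ := by simp; ring

variable {F : Type*} [NormedAddCommGroup F] [NormedSpace ℝ F]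

/-- Reduces to real values by composing with continuous functionals (Hahn–Banach). Vector values are
needed to iterate the estimate, since `fderiv ℝ u` is operator-valued. -/
theorem norm_fderiv_le_of_harmonic {u : Space d → F} {x : Space d} {ρ M : ℝ} (hρ : 0 < ρ)
    (hu : HarmonicOnNhd u (closedBall x ρ)) (hM : ∀ y ∈ closedBall x ρ, ‖u y‖ ≤ M) :
    ‖fderiv ℝ u x‖ ≤ d ^ 2 / ρ * M := by
  have hM0 : 0 ≤ M := (norm_nonneg _).trans (hM x (by simp [hρ.le]))
  refine ContinuousLinearMap.opNorm_le_bound _ (by positivity) fun v => ?_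
  refine NormedSpace.norm_le_dual_bound ℝ _ (by positivity) fun l => ?_
  have hx : DifferentiableAt ℝ u x := (hu x (by simp [hρ.le])).1.differentiableAt (by simp)
  have h1 := norm_fderiv_le_of_harmonic_real hρ (hu.comp_CLM l) (M := ‖l‖ * M) fun y hy =>
    (l.le_opNorm (u y)).trans (by have := hM y hy; gcongr)
  rw [(l.hasFDerivAt.comp x hx.hasFDerivAt).fderiv] at h1
  calc ‖l (fderiv ℝ u x v)‖ = ‖(l ∘L fderiv ℝ u x) v‖ := rfl
    _ ≤ ‖l ∘L fderiv ℝ u x‖ * ‖v‖ := ContinuousLinearMap.le_opNorm _ _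
    _ ≤ d ^ 2 / ρ * (‖l‖ * M) * ‖v‖ := by gcongr
    _ = d ^ 2 / ρ * M * ‖v‖ * ‖l‖ := by ring

section
variable {E F : Type*} [NormedAddCommGroup E] [InnerProductSpace ℝ E] [FiniteDimensional ℝ E]
  [NormedAddCommGroup F] [NormedSpace ℝ F]

/-- The third derivative is symmetric, so the direction `v` can be moved past the two traced ones:
`Δ(Du) v = D(Δu) v = 0`. Symmetry of `D²u` near `x`, differentiated, swaps the last two arguments;
symmetry of `D²(Du)` at `x` swaps the first two. -/
theorem laplacian_fderiv_eq_zero {u : E → F} {x : E} (hu : ContDiffAt ℝ 3 u x)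
    (h : Δ u =ᶠ[𝓝 x] 0) : Δ (fderiv ℝ u) x = 0 := by
  have hD : ContDiffAt ℝ 2 (fderiv ℝ u) x := hu.fderiv_right (by norm_num)
  have hDD : DifferentiableAt ℝ (fderiv ℝ (fderiv ℝ u)) x :=
    (hD.fderiv_right (m := 1) (by norm_num)).differentiableAt (by simp)
  have happ : ∀ a b c : E, HasFDerivAt (fun y => fderiv ℝ (fderiv ℝ u) y b c)
      ((fderiv ℝ (fderiv ℝ (fderiv ℝ u)) x).flip b |>.flip c) x := fun a b c => by
    have h1 := hDD.hasFDerivAt.clm_apply (hasFDerivAt_const b x)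
    have h2 := h1.clm_apply (hasFDerivAt_const c x)
    convert! h2 using 1
    ext v
    simp
  have hsymm : ∀ a b c : E, fderiv ℝ (fderiv ℝ (fderiv ℝ u)) x a b c =
      fderiv ℝ (fderiv ℝ (fderiv ℝ u)) x a c b := fun a b c => by
    have h1 : (fun y => fderiv ℝ (fderiv ℝ u) y b c) =ᶠ[𝓝 x]
        fun y => fderiv ℝ (fderiv ℝ u) y c b := by
      filter_upwards [(hu.of_le (m := 2) (by norm_num)).eventually (by simp)] with y hy
      exact hy.isSymmSndFDerivAt (by simp) b c
    have h2 := ((happ a b c).congr_of_eventuallyEq h1.symm).unique (happ a c b)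
    exact congr($h2 a)
  have hsymm' : ∀ a b c : E, fderiv ℝ (fderiv ℝ (fderiv ℝ u)) x a b c =
      fderiv ℝ (fderiv ℝ (fderiv ℝ u)) x b a c := fun a b c => by
    have := hD.isSymmSndFDerivAt (by simp) a b
    exact congr($this c)
  rw [laplacian_eq_iteratedFDeriv_stdOrthonormalBasis]
  rw [laplacian_eq_iteratedFDeriv_stdOrthonormalBasis] at h
  ext v
  simp only [iteratedFDeriv_two_apply, Matrix.cons_val_zero, Matrix.cons_val_one,
    sum_apply] at h ⊢
  have h1 := HasFDerivAt.fun_sum (u := Finset.univ) fun i (_ : i ∈ Finset.univ) =>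
    happ 0 (stdOrthonormalBasis ℝ E i) (stdOrthonormalBasis ℝ E i)
  have h2 := (h1.congr_of_eventuallyEq h.symm).unique (hasFDerivAt_const (0 : F) x)
  have h3 := congr($h2 v)
  simp only [sum_apply, ContinuousLinearMap.flip_apply] at h3
  rw [← h3]
  exact Finset.sum_congr rfl fun i _ => by rw [hsymm, hsymm']

theorem harmonicAt_fderiv {u : E → F} {x : E} (hu : ContDiffAt ℝ 3 u x)
    (h : Δ u =ᶠ[𝓝 x] 0) : HarmonicAt (fderiv ℝ u) x := by
  refine ⟨hu.fderiv_right (by norm_num), ?_⟩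
  filter_upwards [hu.eventually (by simp), h.eventuallyEq_nhds] with y h1 h2
  exact laplacian_fderiv_eq_zero h1 h2

end

/-- Interior estimates for the derivatives of a harmonic function. -/
theorem norm_iteratedFDeriv_le_of_harmonic {F : Type} [NormedAddCommGroup F] [NormedSpace ℝ F]
    (m : ℕ) {u : Space d → F} {r ρ M : ℝ} (hρ : 0 < ρ)
    (hc : ∀ y ∈ closedBall 0 (r + m * ρ), ContDiffAt ℝ ∞ u y)
    (hu : HarmonicOnNhd u (closedBall 0 (r + m * ρ)))
    (hM : ∀ y ∈ closedBall 0 (r + m * ρ), ‖u y‖ ≤ M) {x : Space d} (hx : x ∈ closedBall 0 r) :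
    ‖iteratedFDeriv ℝ m u x‖ ≤ (d ^ 2 / ρ) ^ m * M := by
  -- The step applies the induction hypothesis to `fderiv ℝ u`, which is again harmonic. Each
  -- derivative costs `ρ` of the radius and a factor `d ^ 2 / ρ`.
  induction m generalizing F u M with
  | zero => simpa using hM x (by simpa using hx)
  | succ m ih =>
    have hle : r + m * ρ + ρ = r + (m + 1 : ℕ) * ρ := by push_cast; ring
    have hsub : ∀ y ∈ closedBall (0 : Space d) (r + m * ρ),
        closedBall y ρ ⊆ closedBall 0 (r + (m + 1 : ℕ) * ρ) := fun y hy => by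
      rw [← hle]
      refine closedBall_subset_closedBall' ?_
      rw [mem_closedBall] at hy
      linarith
    have hmem : ∀ y ∈ closedBall (0 : Space d) (r + m * ρ),
        y ∈ closedBall (0 : Space d) (r + (m + 1 : ℕ) * ρ) := fun y hy =>
      hsub y hy (by simp [hρ.le])
    rw [← norm_iteratedFDeriv_fderiv, pow_succ, mul_assoc]
    refine ih (fun y hy => (hc y (hmem y hy)).fderiv_right (by simp))
      (fun y hy => harmonicAt_fderiv ((hc y (hmem y hy)).of_le (WithTop.coe_le_coe.2 le_top))
        (hu y (hmem y hy)).2) fun y hy => ?_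
    exact norm_fderiv_le_of_harmonic hρ (hu.mono (hsub y hy)) fun z hz => hM z (hsub y hy hz)

/-! ### Functionals on `H(𝔻)` are bounded by a sup norm. -/

theorem HarmonicOnDisk.contDiffAt_top (u : HarmonicOnDisk d) {x : Space d} (hx : x ∈ disk d) :
    ContDiffAt ℝ ∞ u.toFun x :=
  (show ContDiffOn ℝ ∞ u.toFun (disk d) from u.2.1).contDiffAt (isOpen_ball.mem_nhds hx)

theorem HarmonicOnDisk.harmonicAt (u : HarmonicOnDisk d) {x : Space d} (hx : x ∈ disk d) :
    HarmonicAt u.toFun x :=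
  ⟨u.contDiffAt hx 2, Filter.eventuallyEq_of_mem (isOpen_ball.mem_nhds hx) fun y hy => u.2.2.1 y hy⟩

theorem CompactInDisk.exists_subset_closedBall (K : CompactInDisk d) :
    ∃ r, 0 ≤ r ∧ r < 1 ∧ K.1 ⊆ closedBall 0 r := by
  obtain ⟨r, hr, h⟩ := exists_lt_subset_ball (x := (0 : Space d)) K.2.1.isClosed K.2.2
  refine ⟨max r 0, le_max_right _ _, by simpa using hr, h.trans ?_⟩
  exact ball_subset_closedBall.trans (closedBall_subset_closedBall (le_max_left _ _))

theorem harmonicSeminorm_le (i : CompactInDisk d × ℕ) : ∃ r C : ℝ, 0 < r ∧ r < 1 ∧ 0 ≤ C ∧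
    ∀ (u : HarmonicOnDisk d) (M : ℝ), (∀ x ∈ closedBall (0 : Space d) r, |u.toFun x| ≤ M) →
      harmonicSeminorm d i u ≤ C * M := by
  obtain ⟨s, hs0, hs1, hK⟩ := i.1.exists_subset_closedBall
  -- Chosen so that `i.2 + 1` steps of length `ρ` lead from radius `s` exactly to `(1 + s) / 2 < 1`;
  -- the `+ 1` also covers order zero.
  set ρ : ℝ := (1 - s) / (2 * (i.2 + 1)) with hρd
  have hρ : 0 < ρ := by
    have : 0 < 1 - s := by linarith
    positivity
  have hlt : s + i.2 * ρ < (1 + s) / 2 := by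
    have h1 : ((i.2 : ℝ) + 1) * ρ = (1 - s) / 2 := by rw [hρd]; field_simp
    nlinarith
  have hdisk : closedBall (0 : Space d) ((1 + s) / 2) ⊆ disk d :=
    closedBall_subset_ball (by linarith)
  have hsub : closedBall (0 : Space d) (s + i.2 * ρ) ⊆ closedBall 0 ((1 + s) / 2) :=
    closedBall_subset_closedBall hlt.le
  refine ⟨(1 + s) / 2, (d ^ 2 / ρ) ^ i.2, by linarith, by linarith, by positivity,
    fun u M hM => ?_⟩
  have hM0 : 0 ≤ M := (abs_nonneg _).trans (hM 0 (by simp; linarith))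
  refine Real.iSup_le (fun x => ?_) (by positivity)
  exact norm_iteratedFDeriv_le_of_harmonic i.2 hρ
    (fun y hy => u.contDiffAt_top (hdisk (hsub hy))) (fun y hy => u.harmonicAt (hdisk (hsub hy)))
    (fun y hy => hM y (hsub hy)) (hK x.2)

/-- Elements of the dual are continuous for the sup norm on a closed ball in `𝔻`. -/
theorem HarmonicDual.exists_bound (T : HarmonicDual d) : ∃ r C : ℝ, 0 < r ∧ r < 1 ∧ 0 ≤ C ∧
    ∀ (u : HarmonicOnDisk d) (M : ℝ), (∀ x ∈ closedBall (0 : Space d) r, |u.toFun x| ≤ M) →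
      |T u| ≤ C * M := by
  obtain ⟨s, C, -, hC⟩ := Seminorm.bound_of_continuous (harmonicOnDisk_withSeminorms d)
    ((normSeminorm ℝ ℝ).comp T.toLinearMap) (by exact T.continuous.norm)
  -- Only finitely many seminorms bound `T`, so the largest of their radii is still less than `1`.
  have hfin : ∃ r C : ℝ, 0 < r ∧ r < 1 ∧ 0 ≤ C ∧ ∀ (u : HarmonicOnDisk d) (M : ℝ),
      (∀ x ∈ closedBall (0 : Space d) r, |u.toFun x| ≤ M) →
        s.sup (harmonicSeminorm d) u ≤ C * M := by
    classical
    clear hC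
    induction s using Finset.induction_on with
    | empty =>
      refine ⟨1 / 2, 0, by norm_num, by norm_num, le_rfl, fun u M _ => by simp⟩
    | insert i s _ ih =>
      obtain ⟨r, C, hr0, hr1, hC0, h⟩ := ih
      obtain ⟨r', C', hr0', hr1', hC0', h'⟩ := harmonicSeminorm_le i
      refine ⟨max r r', max C C', lt_max_of_lt_left hr0, max_lt hr1 hr1', le_max_of_le_left hC0,
        fun u M hM => ?_⟩
      have hM0 : 0 ≤ M := (abs_nonneg _).trans (hM 0 (by simp [hr0.le]))
      rw [Finset.sup_insert, Seminorm.sup_apply]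
      refine sup_le ((h' u M fun x hx => hM x ?_).trans ?_) ((h u M fun x hx => hM x ?_).trans ?_)
      · exact closedBall_subset_closedBall (le_max_right _ _) hx
      · gcongr; exact le_max_right _ _
      · exact closedBall_subset_closedBall (le_max_left _ _) hx
      · gcongr; exact le_max_left _ _
  obtain ⟨r, C', hr0, hr1, hC0, h⟩ := hfin
  refine ⟨r, C * C', hr0, hr1, by positivity, fun u M hM => ?_⟩
  calc |T u| ≤ C * s.sup (harmonicSeminorm d) u := hC u
    _ ≤ C * (C' * M) := by gcongr; exact h u M hM
    _ = C * C' * M := by ring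

/-! ### Density of harmonic polynomials in `H(𝔻)`. -/

theorem coeff_polyLaplacian (P : MvPolynomial (Fin d) ℝ) (β : Fin d →₀ ℕ) :
    coeff β (polyLaplacian d P) = ∑ i, coeff (β + Finsupp.single i 2) P * (β i + 2) * (β i + 1) := by
  simp only [polyLaplacian, LinearMap.sum_apply, LinearMap.comp_apply, Derivation.coeFn_coe,
    coeff_sum, coeff_pderiv]
  refine Finset.sum_congr rfl fun i _ => ?_
  rw [add_assoc, ← Finsupp.single_add]
  simp
  ring_nf
  simp

/-- The coefficient of `ΔP` at `β` involves only coefficients of `P` in degree `|β| + 2`, so `Δ`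
respects the grading. -/
theorem homogeneousComponent_mem_harm {P : MvPolynomial (Fin d) ℝ} (hP : polyLaplacian d P = 0)
    (n : ℕ) : homogeneousComponent n P ∈ harm d n := by
  refine ⟨homogeneousComponent_isHomogeneous n P, LinearMap.mem_ker.2 (MvPolynomial.ext _ _ fun β => ?_)⟩
  have h := congr(coeff β $hP)
  rw [coeff_polyLaplacian] at h ⊢
  simp only [coeff_homogeneousComponent, map_add, Finsupp.degree_single]
  split_ifs
  · exact h
  · simp

theorem totalDegree_polyLaplacian_le {P : MvPolynomial (Fin d) ℝ} {n : ℕ}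
    (hP : P.totalDegree ≤ n + 2) : (polyLaplacian d P).totalDegree ≤ n := by
  refine Finset.sup_le fun β hβ => ?_
  rw [mem_support_iff, coeff_polyLaplacian] at hβ
  obtain ⟨i, -, hi⟩ := Finset.exists_ne_zero_of_sum_ne_zero hβ
  have h1 := (le_totalDegree (mem_support_iff.2 (left_ne_zero_of_mul (left_ne_zero_of_mul hi)))).trans hP
  rw [Finsupp.sum_add_index' (by simp) (by simp), Finsupp.sum_single_index rfl] at h1
  omega

/-- The maximum principle for harmonic functions on a ball. -/
theorem abs_le_of_harmonic (hd : d ≠ 0) {u : Space d → ℝ} {r ε : ℝ}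
    (hu : HarmonicOnNhd u (closedBall 0 r)) (h : ∀ y, ‖y‖ = r → |u y| ≤ ε) {x : Space d}
    (hx : x ∈ closedBall 0 r) : |u x| ≤ ε := by
  have key : ∀ v : Space d → ℝ, HarmonicOnNhd v (closedBall 0 r) → (∀ y, ‖y‖ = r → v y ≤ ε) →
      v x ≤ ε := fun v hv h => by
    have hH : ∀ y ∈ closedBall (0 : Space d) r, HarmonicAt (v - fun _ => ε) y := fun y hy =>
      (hv y hy).sub (harmonicAt_const ε)
    have := nonpos_of_laplacian_nonneg hd (isCompact_closedBall (0 : Space d) r)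
      (f := v - fun _ => ε) (fun y hy => (hH y hy).1.continuousAt.continuousWithinAt)
      (fun y hy => ?_) hx
    · simpa using this
    have hyr : ‖y‖ ≤ r := by simpa using hy
    rcases hyr.eq_or_lt with h1 | h1
    · left; simpa using h y h1
    · right
      exact ⟨closedBall_mem_nhds_of_mem (by simpa using h1), (hH y hy).1,
        (hH y hy).2.self_of_nhds.ge⟩
  refine abs_le'.2 ⟨key u hu fun y hy => (le_abs_self _).trans (h y hy),
    key (-u) hu.neg fun y hy => (neg_le_abs _).trans (h y hy)⟩

/-- The ball contains a box with infinite sides, and a polynomial vanishing on a product of infinite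
sets is zero. -/
theorem eq_zero_of_evalAt_eq_zero_ball {r : ℝ} (hr : 0 < r) {P : MvPolynomial (Fin d) ℝ}
    (h : ∀ x ∈ ball (0 : Space d) r, evalAt P x = 0) : P = 0 := by
  have hn : (fun x : Fin d → ℝ => (WithLp.toLp 2 x : Space d)) ⁻¹' ball 0 r ∈ 𝓝 0 :=
    (PiLp.continuous_toLp 2 _).continuousAt.preimage_mem_nhds
      (by simpa using ball_mem_nhds (0 : Space d) hr)
  rw [nhds_pi, Filter.mem_pi'] at hn
  obtain ⟨I, t, ht, hsub⟩ := hn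
  refine funext_set t (fun i => infinite_of_mem_nhds (0 : ℝ) (ht i)) fun x hx => ?_
  rw [map_zero]
  exact h _ (hsub fun i _ => hx i trivial)

/-- A polynomial agrees on the sphere of radius `r` with a harmonic polynomial. -/
theorem exists_harmonic_eq_on_sphere (hd : d ≠ 0) {r : ℝ} (hr : 0 < r)
    (P : MvPolynomial (Fin d) ℝ) : ∃ Q : MvPolynomial (Fin d) ℝ, polyLaplacian d Q = 0 ∧
      ∀ y, ‖y‖ = r → evalAt Q y = evalAt P y := by
  -- `B` vanishes on the sphere, so `Q = P - B q` has the right boundary values, and it remains to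
  -- solve `Δ(B q) = ΔP`. The map `q ↦ Δ(B q)` preserves the finite-dimensional space of polynomials
  -- of degree at most `n`. It is injective there: if `B q` is harmonic, the maximum principle gives
  -- `B q = 0` on the ball, hence `q = 0`. It is therefore surjective.
  let B : MvPolynomial (Fin d) ℝ := C (r ^ 2) - ∑ i, X i ^ 2
  have hB : ∀ q y, evalAt (B * q) y = (r ^ 2 - ‖y‖ ^ 2) * evalAt q y := fun q y => by
    rw [← evalAt_sum_X_sq]; simp [B, evalAt]
  have hBdeg : B.totalDegree ≤ 2 := by
    refine (totalDegree_sub _ _).trans (max_le ((totalDegree_C _).le.trans (by norm_num)) ?_)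
    exact totalDegree_finsetSum_le fun i _ => by simp
  set n := P.totalDegree
  let V := restrictTotalDegree (Fin d) ℝ n
  let L₀ : MvPolynomial (Fin d) ℝ →ₗ[ℝ] MvPolynomial (Fin d) ℝ :=
    polyLaplacian d ∘ₗ LinearMap.mulLeft ℝ B
  have hL₀ : ∀ q ∈ V, L₀ q ∈ V := fun q hq => by
    rw [mem_restrictTotalDegree] at hq ⊢
    exact totalDegree_polyLaplacian_le ((totalDegree_mul _ _).trans (by omega))
  have hinj : Function.Injective (L₀.restrict hL₀) := by
    rw [injective_iff_map_eq_zero]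
    rintro ⟨q, hq⟩ h
    have h1 : polyLaplacian d (B * q) = 0 := congrArg Subtype.val h
    refine Subtype.ext (eq_zero_of_evalAt_eq_zero_ball hr fun x hx => ?_)
    have h2 := abs_le_of_harmonic hd (ε := 0) (fun y _ => harmonicAt_evalAt h1 y)
      (fun y (hy : ‖y‖ = r) => by simp [hB, hy]) (ball_subset_closedBall hx)
    rw [hB, abs_nonpos_iff, mul_eq_zero] at h2
    have hx' : ‖x‖ < r := by simpa using hx
    refine h2.resolve_left ?_
    nlinarith [norm_nonneg x]
  obtain ⟨⟨q, hq⟩, h⟩ := LinearMap.injective_iff_surjective.1 hinj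
    ⟨polyLaplacian d P, by
      rw [mem_restrictTotalDegree]
      exact totalDegree_polyLaplacian_le (by omega)⟩
  have h1 : polyLaplacian d (B * q) = polyLaplacian d P := congrArg Subtype.val h
  refine ⟨P - B * q, by rw [map_sub, h1, sub_self], fun y hy => ?_⟩
  have h2 : evalAt (P - B * q) y = evalAt P y - evalAt (B * q) y := by simp [evalAt]
  rw [h2, hB, hy]; simp

/-- Stone–Weierstrass: the coordinate functions separate points. -/
theorem exists_polynomial_near {K : Set (Space d)} (hK : IsCompact K) {f : Space d → ℝ}
    (hf : ContinuousOn f K) {ε : ℝ} (hε : 0 < ε) :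
    ∃ P : MvPolynomial (Fin d) ℝ, ∀ x ∈ K, |evalAt P x - f x| < ε := by
  have : CompactSpace K := isCompact_iff_compactSpace.1 hK
  let φ : MvPolynomial (Fin d) ℝ →ₐ[ℝ] C(K, ℝ) :=
    aeval fun i => ⟨fun x => x.1 i, by fun_prop⟩
  have hφ : ∀ P (x : K), φ P x = evalAt P x := fun P x => by
    induction P using MvPolynomial.induction_on with
    | C a => simp [evalAt, φ]
    | add P Q hP hQ => simp only [map_add, ContinuousMap.add_apply, hP, hQ, evalAt]
    | mul_X P i hP => simp only [map_mul, ContinuousMap.mul_apply, hP, evalAt]; simp [φ]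
  obtain ⟨⟨_, P, rfl⟩, h⟩ := ContinuousMap.exists_mem_subalgebra_near_continuous_of_separatesPoints
    φ.range (fun x y hxy => by
      have : ∃ i, x.1 i ≠ y.1 i := by
        by_contra! h
        exact hxy (Subtype.ext (PiLp.ext h))
      obtain ⟨i, hi⟩ := this
      exact ⟨_, ⟨φ (X i), ⟨X i, rfl⟩, rfl⟩, by simpa [φ] using hi⟩) (fun x : K => f x)
    hf.domRestrict ε hε
  refine ⟨P, fun x hx => ?_⟩
  have := h ⟨x, hx⟩
  rw [Real.norm_eq_abs] at this
  simpa [hφ] using this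

/-- The homogeneous component of degree `n` of a harmonic polynomial. -/
def harmComponent (Q : MvPolynomial (Fin d) ℝ) (hQ : polyLaplacian d Q = 0) (n : ℕ) : Harm d n :=
  ⟨homogeneousComponent n Q, homogeneousComponent_mem_harm hQ n⟩

/-- The element of `H(𝔻)` given by a harmonic polynomial. -/
def ofHarmonicPolynomial (Q : MvPolynomial (Fin d) ℝ) (hQ : polyLaplacian d Q = 0) :
    HarmonicOnDisk d :=
  ∑ n ∈ Finset.range (Q.totalDegree + 1), restrictDisk d n (harmComponent Q hQ n)

theorem ofHarmonicPolynomial_toFun (Q : MvPolynomial (Fin d) ℝ) (hQ : polyLaplacian d Q = 0)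
    {x : Space d} (hx : x ∈ disk d) : (ofHarmonicPolynomial Q hQ).toFun x = evalAt Q x := by
  rw [ofHarmonicPolynomial, map_sum, Finset.sum_apply]
  simp only [restrictDisk_apply _ hx]
  conv_rhs => rw [← sum_homogeneousComponent Q]
  simp only [evalAt, map_sum]
  rfl

/-- Harmonic polynomials are dense in `H(𝔻)`. -/
theorem HarmonicDual.eq_zero (hd : d ≠ 0) {T : HarmonicDual d}
    (hT : ∀ n P, T (restrictDisk d n P) = 0) : T = 0 := by
  ext u
  obtain ⟨r, C, hr0, hr1, hC0, hb⟩ := T.exists_bound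
  have hdisk : closedBall (0 : Space d) r ⊆ disk d := closedBall_subset_ball hr1
  suffices key : ∀ ε : ℝ, 0 < ε → |T u| ≤ C * ε by
    have ht : Filter.Tendsto (fun ε : ℝ => C * ε) (𝓝[>] 0) (𝓝 0) := by
      have : Continuous fun ε : ℝ => C * ε := by fun_prop
      simpa using (this.tendsto 0).mono_left nhdsWithin_le_nhds
    exact abs_nonpos_iff.1 (ge_of_tendsto ht (Filter.eventually_of_mem self_mem_nhdsWithin key))
  intro ε hε
  -- `P` need not be harmonic, but the harmonic `Q` with the same values on the sphere of radius `r`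
  -- is within `ε` of `u` there, hence on the whole ball by the maximum principle.
  obtain ⟨P, hP⟩ := exists_polynomial_near (isCompact_closedBall (0 : Space d) r)
    (fun x hx => (u.contDiffAt (hdisk hx) 0).continuousAt.continuousWithinAt) hε
  obtain ⟨Q, hQ, hQP⟩ := exists_harmonic_eq_on_sphere hd hr0 P
  have hTQ : T (ofHarmonicPolynomial Q hQ) = 0 := by
    rw [ofHarmonicPolynomial, map_sum]
    exact Finset.sum_eq_zero fun n _ => hT n _
  have h := hb (ofHarmonicPolynomial Q hQ - u) ε fun x hx => abs_le_of_harmonic hd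
    (fun y hy => (ofHarmonicPolynomial Q hQ - u).harmonicAt (hdisk hy)) (fun y hy => ?_) hx
  · rwa [map_sub, hTQ, zero_sub, abs_neg] at h
  · have hy' : y ∈ closedBall (0 : Space d) r := by simp [hy]
    rw [map_sub, Pi.sub_apply, ofHarmonicPolynomial_toFun Q hQ (hdisk hy'), hQP y hy]
    exact (hP y hy').le

theorem dualExpansion_injective (d : ℕ) [Fact (3 ≤ d)] :
    Function.Injective (dualExpansion d) := by
  rw [injective_iff_map_eq_zero]
  intro T hT
  refine HarmonicDual.eq_zero (by have := Fact.out (p := 3 ≤ d); omega) fun n P => ?_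
  rw [← dualExpansion_spec, ← inner_harm, hT]
  exact inner_zero_left _

/-! ### Sup norm against `L²` norm on the sphere, and decay of the components of a functional. -/

theorem abs_evalAt_le {n : ℕ} (P : Harm d n) {M : ℝ} {ξ₀ : Space d} (hξ₀ : ‖ξ₀‖ = 1)
    (hM : ∀ ξ : Space d, ‖ξ‖ = 1 → |evalAt P.poly ξ| ≤ M) (y : Space d) :
    |evalAt P.poly y| ≤ ‖y‖ ^ n * M := by
  obtain ⟨ξ, hξ, hy⟩ : ∃ ξ : Space d, ‖ξ‖ = 1 ∧ y = ‖y‖ • ξ := by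
    rcases eq_or_ne y 0 with rfl | h
    · exact ⟨ξ₀, hξ₀, by simp⟩
    · exact ⟨‖y‖⁻¹ • y, by simp [norm_smul, h], by simp [h]⟩
  conv_lhs => rw [hy, evalAt_smul, abs_mul, abs_pow, abs_norm]
  have := hM ξ hξ
  gcongr

/-- A Bernstein-type inequality: apply the gradient estimate on a ball of radius `1 / (n + 1)`, on
which homogeneity gives `|P| ≤ (1 + 1 / (n + 1)) ^ n * M ≤ e * M ≤ 3 * M`. -/
theorem norm_fderiv_evalAt_le {n : ℕ} (P : Harm d n) {M : ℝ} {ξ₀ : Space d} (hξ₀ : ‖ξ₀‖ = 1)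
    (hM : ∀ ξ : Space d, ‖ξ‖ = 1 → |evalAt P.poly ξ| ≤ M) {x : Space d} (hx : x ∈ closedBall 0 1) :
    ‖fderiv ℝ (evalAt P.poly) x‖ ≤ 3 * d ^ 2 * (n + 1) * M := by
  have hM0 : 0 ≤ M := (abs_nonneg _).trans (hM _ hξ₀)
  set ρ : ℝ := 1 / (n + 1) with hρd
  have hρ : 0 < ρ := by positivity
  have hexp : (1 + ρ) ^ n ≤ 3 := by
    calc (1 + ρ) ^ n ≤ Real.exp ρ ^ n := by
          gcongr; rw [add_comm]; exact Real.add_one_le_exp ρ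
      _ = Real.exp (n * ρ) := by rw [← Real.exp_nat_mul]
      _ ≤ Real.exp 1 := by
          gcongr
          rw [hρd, mul_one_div, div_le_one (by positivity)]
          linarith
      _ ≤ 3 := by linarith [Real.exp_one_lt_d9]
  have h := norm_fderiv_le_of_harmonic_real hρ (x := x) (u := evalAt P.poly) (M := 3 * M)
    (fun y _ => harmonicAt_evalAt (LinearMap.mem_ker.1 P.2.2) y) fun y hy => by
      have hy1 : ‖y‖ ≤ 1 + ρ := by
        have h1 : ‖x‖ ≤ 1 := by simpa using hx
        have h2 : ‖y - x‖ ≤ ρ := by simpa [dist_eq_norm] using hy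
        calc ‖y‖ = ‖x + (y - x)‖ := by simp
          _ ≤ 1 + ρ := (norm_add_le _ _).trans (add_le_add h1 h2)
      refine (abs_evalAt_le P hξ₀ hM y).trans ?_
      gcongr
      exact (pow_le_pow_left₀ (norm_nonneg _) hy1 n).trans hexp
  refine h.trans (le_of_eq ?_)
  rw [hρd]; field_simp

/-- On a cap around a maximum point on the unit sphere, a harmonic polynomial is large. -/
theorem half_le_abs_evalAt {n : ℕ} (P : Harm d n) {ξ₀ : Space d} (hξ₀ : ‖ξ₀‖ = 1)
    (hM : ∀ ξ : Space d, ‖ξ‖ = 1 → |evalAt P.poly ξ| ≤ |evalAt P.poly ξ₀|) (hd : d ≠ 0)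
    {η : Space d} (hη : ‖η‖ = 1) (h : dist η ξ₀ ≤ 1 / (6 * d ^ 2 * (n + 1))) :
    |evalAt P.poly ξ₀| / 2 ≤ |evalAt P.poly η| := by
  have hd' : (0 : ℝ) < d := by exact_mod_cast Nat.pos_of_ne_zero hd
  set M := |evalAt P.poly ξ₀|
  -- The chord from `ξ₀` to `η` lies in the unit ball. The cap radius is chosen so that the gradient
  -- bound times it equals `M / 2`.
  have h1 := (convex_closedBall (0 : Space d) 1).norm_image_sub_le_of_norm_fderiv_le (𝕜 := ℝ)
    (fun x _ => (contDiff_evalAt P.poly (m := 1)).differentiable (by simp) x)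
    (fun x hx => norm_fderiv_evalAt_le P hξ₀ hM hx) (x := ξ₀) (y := η) (by simp [hξ₀]) (by simp [hη])
  have h2 : ‖evalAt P.poly η - evalAt P.poly ξ₀‖ ≤ M / 2 := by
    refine h1.trans ?_
    rw [← dist_eq_norm]
    calc 3 * d ^ 2 * (n + 1) * M * dist η ξ₀
        ≤ 3 * d ^ 2 * (n + 1) * M * (1 / (6 * d ^ 2 * (n + 1))) := by gcongr
      _ = M / 2 := by field_simp; ring
  rw [Real.norm_eq_abs, abs_sub_comm] at h2
  linarith [abs_sub_abs_le_abs_sub (evalAt P.poly ξ₀) (evalAt P.poly η)]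

theorem toSphereBallBound_eq (hd : d ≠ 0) {δ : ℝ} (hδ : 0 < δ) (hδ2 : δ ≤ 2) :
    (Measure.toSphereBallBound d δ : ℝ) = d * (δ / 4) ^ d := by
  rw [Measure.toSphereBallBound, if_pos ⟨hd, hδ⟩, min_eq_left (by simpa using hδ2)]
  simp [hδ.le]

/-- The sup norm on the sphere of a harmonic polynomial of degree `n` is bounded by its `L²` norm up
to a polynomial factor in `n`. -/
theorem abs_evalAt_le_norm (d : ℕ) [Fact (3 ≤ d)] : ∃ C : ℝ, 0 ≤ C ∧
    ∀ (n : ℕ) (P : Harm d n) (ξ : Space d), ‖ξ‖ = 1 →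
      |evalAt P.poly ξ| ≤ C * ((n : ℝ) + 1) ^ d * ‖P‖ := by
  have hd3 : 3 ≤ d := Fact.out
  have hd : d ≠ 0 := by omega
  have : Nonempty (Fin d) := ⟨⟨0, Nat.pos_of_ne_zero hd⟩⟩
  have hd1 : (1 : ℝ) ≤ d := by exact_mod_cast Nat.pos_of_ne_zero hd
  refine ⟨2 * (24 * d ^ 2) ^ d, by positivity, fun n P ξ hξ => ?_⟩
  obtain ⟨ξ₀, hξ₀, hmax⟩ := (isCompact_sphere (0 : Space d) 1).exists_isMaxOn ⟨ξ, by simp [hξ]⟩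
    ((contDiff_evalAt P.poly (m := 0)).continuous.abs.continuousOn)
  have hM : ∀ ξ : Space d, ‖ξ‖ = 1 → |evalAt P.poly ξ| ≤ |evalAt P.poly ξ₀| := fun ξ hξ =>
    hmax (show ξ ∈ sphere (0 : Space d) 1 by simp [hξ])
  refine (hM ξ hξ).trans ?_
  set M := |evalAt P.poly ξ₀|
  set σ := (volume : Measure (Space d)).toSphere
  set δ : ℝ := 1 / (6 * d ^ 2 * (n + 1)) with hδd
  have hδ : 0 < δ := by positivity
  have hδ2 : δ ≤ 2 := by
    rw [hδd, div_le_iff₀ (by positivity)]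
    have : (0 : ℝ) ≤ n := n.cast_nonneg
    nlinarith [one_le_pow₀ hd1 (n := 2)]
  set b₁ := (volume : Measure (Space d)).real (ball 0 1)
  have hb₁ : 0 < b₁ := ENNReal.toReal_pos (measure_ball_pos _ _ one_pos).ne' measure_ball_lt_top.ne
  have hσ : σ.real Set.univ = d * b₁ := by
    rw [Measure.toSphere_real_apply_univ, finrank_euclideanSpace_fin]
  -- Relative to the total mass `d * b₁` the cap has measure at least `(δ / 4) ^ d`, and `|P| ≥ M /
  -- 2` on it; hence `‖P‖² ≥ (δ / 4) ^ d * (M / 2) ^ 2`.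
  have hcap : d * (δ / 4) ^ d * b₁ ≤ σ.real (ball ⟨ξ₀, hξ₀⟩ δ) := by
    have := Measure.toSphereBallBound_mul_measureReal_unitBall_le_toSphere_ball
      (volume : Measure (Space d)) hδ ⟨ξ₀, hξ₀⟩
    rwa [finrank_euclideanSpace_fin, toSphereBallBound_eq hd hδ hδ2] at this
  have hint : σ.real (ball ⟨ξ₀, hξ₀⟩ δ) * (M / 2) ^ 2 ≤
      ∫ η : sphere (0 : Space d) 1, evalAt P.poly η * evalAt P.poly η ∂σ := by
    calc σ.real (ball ⟨ξ₀, hξ₀⟩ δ) * (M / 2) ^ 2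
        = ∫ _ in ball (⟨ξ₀, hξ₀⟩ : sphere (0 : Space d) 1) δ, (M / 2) ^ 2 ∂σ := by simp
      _ ≤ ∫ η in ball (⟨ξ₀, hξ₀⟩ : sphere (0 : Space d) 1) δ,
            evalAt P.poly η * evalAt P.poly η ∂σ := by
          refine setIntegral_mono_on (by simp) (integrable_evalAt _ _).integrableOn
            measurableSet_ball fun η hη => ?_
          have h1 := half_le_abs_evalAt P (by simpa using hξ₀) hM hd (η := η) (by simp)
            (le_of_lt hη)
          rw [← sq, ← sq_abs (evalAt P.poly η)]
          gcongr
      _ ≤ _ := setIntegral_le_integral (integrable_evalAt _ _)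
          (Filter.Eventually.of_forall fun η => mul_self_nonneg _)
  have hnorm : ‖P‖ ^ 2 = (d * b₁)⁻¹ *
      ∫ η : sphere (0 : Space d) 1, evalAt P.poly η * evalAt P.poly η ∂σ := by
    rw [← real_inner_self_eq_norm_sq, inner_harm, sphereInner, average_eq, hσ, smul_eq_mul]
  have hkey : (δ / 4) ^ d * (M / 2) ^ 2 ≤ ‖P‖ ^ 2 := by
    rw [hnorm, inv_mul_eq_div, le_div_iff₀ (by positivity)]
    calc (δ / 4) ^ d * (M / 2) ^ 2 * (d * b₁) = d * (δ / 4) ^ d * b₁ * (M / 2) ^ 2 := by ring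
      _ ≤ _ := (mul_le_mul_of_nonneg_right hcap (sq_nonneg _)).trans hint
  have hδ4 : δ / 4 = (24 * (d : ℝ) ^ 2 * (n + 1))⁻¹ := by rw [hδd]; field_simp; norm_num
  -- `A` is the inverse of `(δ / 4) ^ d`. Since `A ≥ 1`, the bound `(M / 2)² ≤ A ‖P‖²` may be
  -- weakened to `(A ‖P‖)²`, which avoids a square root; any power of `n + 1` would do.
  set A : ℝ := (24 * d ^ 2 * (n + 1)) ^ d with hA
  have hA1 : 1 ≤ A := by
    refine one_le_pow₀ ?_
    have : (0 : ℝ) ≤ n := n.cast_nonneg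
    nlinarith [one_le_pow₀ hd1 (n := 2)]
  rw [hδ4, inv_pow, ← hA, inv_mul_le_iff₀ (by positivity)] at hkey
  have h2 : (M / 2) ^ 2 ≤ (A * ‖P‖) ^ 2 := by
    rw [mul_pow]
    refine hkey.trans ?_
    gcongr
    nlinarith
  have h3 := abs_le_of_sq_le_sq' h2 (by positivity)
  have h4 : 2 * (24 * d ^ 2) ^ d * ((n : ℝ) + 1) ^ d = 2 * A := by
    rw [hA, mul_pow (24 * (d : ℝ) ^ 2)]; ring
  rw [h4]
  linarith [h3.2]

/-- The components of an element of `H'(𝔻)` decay geometrically. -/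
theorem norm_dualExpansion_le {d : ℕ} [Fact (3 ≤ d)] (T : HarmonicDual d) :
    ∃ r C : ℝ, 0 < r ∧ r < 1 ∧ ∀ n, ‖dualExpansion d T n‖ ≤ C * (((n : ℝ) + 1) ^ d * r ^ n) := by
  obtain ⟨r, C, hr0, hr1, hC0, hb⟩ := T.exists_bound
  obtain ⟨C', hC0', h⟩ := abs_evalAt_le_norm d
  have hd : d ≠ 0 := by have := Fact.out (p := 3 ≤ d); omega
  have : Nonempty (Fin d) := ⟨⟨0, Nat.pos_of_ne_zero hd⟩⟩
  obtain ⟨ξ₀, hξ₀⟩ : ∃ ξ₀ : Space d, ‖ξ₀‖ = 1 := exists_norm_eq _ zero_le_one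
  refine ⟨r, C * C', hr0, hr1, fun n => ?_⟩
  set t := dualExpansion d T n
  -- Test `T` on its own component: `T(t) = ‖t‖²`, while homogeneity produces `r ^ n` on the ball of
  -- radius `r`. One factor `‖t‖` is cancelled at the end.
  have h1 := hb (restrictDisk d n t) (r ^ n * (C' * ((n : ℝ) + 1) ^ d * ‖t‖)) fun x hx => by
    rw [restrictDisk_apply _ (closedBall_subset_ball hr1 hx)]
    refine (abs_evalAt_le t hξ₀ (h n t) x).trans ?_
    have : ‖x‖ ≤ r := by simpa using hx
    gcongr
  rw [← dualExpansion_spec, ← inner_harm, real_inner_self_eq_norm_sq, abs_of_nonneg (sq_nonneg _)]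
    at h1
  rcases (norm_nonneg t).eq_or_lt with h0 | h0
  · rw [← h0]; positivity
  · refine le_of_mul_le_mul_right ?_ h0
    linarith

/-! ### Jets at the origin. -/

/-- The derivative of order `n` at the origin, on `H(𝔻)`. -/
def jet (d n : ℕ) :
    HarmonicOnDisk d →L[ℝ] ContinuousMultilinearMap ℝ (fun _ : Fin n => Space d) ℝ where
  toFun u := iteratedFDeriv ℝ n u.toFun 0
  map_add' u v := by
    rw [map_add, iteratedFDeriv_add_apply (u.contDiffAt (by simp [disk]) _)
      (v.contDiffAt (by simp [disk]) _)]
  map_smul' c u := by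
    rw [map_smul, iteratedFDeriv_const_smul_apply (u.contDiffAt (by simp [disk]) _)]; rfl
  cont := by
    -- The norm of the jet is bounded by the seminorm attached to the compact set `{0}` and the
    -- order `n`.
    let K : CompactInDisk d := ⟨{0}, isCompact_singleton, by simp [disk]⟩
    let J : HarmonicOnDisk d →ₗ[ℝ] ContinuousMultilinearMap ℝ (fun _ : Fin n => Space d) ℝ :=
      { toFun := fun u => iteratedFDeriv ℝ n u.toFun 0
        map_add' := fun u v => by
          rw [map_add, iteratedFDeriv_add_apply (u.contDiffAt (by simp [disk]) _)
            (v.contDiffAt (by simp [disk]) _)]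
        map_smul' := fun c u => by
          rw [map_smul, iteratedFDeriv_const_smul_apply (u.contDiffAt (by simp [disk]) _)]; rfl }
    refine (harmonicOnDisk_withSeminorms d).continuous_normedSpace_rng _ J
      ⟨{(K, n)}, 1, fun u => ?_⟩
    rw [Finset.sup_singleton, one_smul]
    exact le_ciSup (u.bddAbove K n) ⟨0, rfl⟩

theorem jet_restrictDisk (n : ℕ) {m : ℕ} (P : Harm d m) :
    jet d n (restrictDisk d m P) = iteratedFDeriv ℝ n (evalAt P.poly) 0 := by
  refine (Filter.EventuallyEq.iteratedFDeriv ℝ ?_ n).self_of_nhds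
  filter_upwards [ball_mem_nhds (0 : Space d) one_pos] with x hx using restrictDisk_apply P hx

/-- Differentiating `P(2x) = 2^m P(x)` at the origin `n` times gives `2^n DⁿP(0) = 2^m DⁿP(0)`. -/
theorem jet_restrictDisk_of_ne {m n : ℕ} (h : m ≠ n) (P : Harm d m) :
    jet d n (restrictDisk d m P) = 0 := by
  rw [jet_restrictDisk]
  ext v
  let g : Space d →L[ℝ] Space d := (2 : ℝ) • ContinuousLinearMap.id ℝ _
  have hg : evalAt P.poly ∘ g = (2 : ℝ) ^ m • evalAt P.poly := by
    ext x
    simpa [g] using evalAt_smul P 2 x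
  have h1 := g.iteratedFDeriv_comp_right (contDiff_evalAt P.poly) 0 (i := n) le_rfl
  rw [hg, iteratedFDeriv_const_smul_apply (contDiff_evalAt P.poly).contDiffAt, map_zero] at h1
  have h2 := congr($h1 v)
  have h3 : (fun i => g (v i)) = fun i => (2 : ℝ) • v i := rfl
  rw [ContinuousMultilinearMap.compContinuousLinearMap_apply, h3,
    ContinuousMultilinearMap.map_smul_univ] at h2
  simp only [smul_apply, Finset.prod_const, Finset.card_univ,
    Fintype.card_fin, smul_eq_mul] at h2
  have h4 : (2 : ℝ) ^ m ≠ 2 ^ n := fun he => h (pow_right_injective₀ (by norm_num) (by norm_num) he)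
  have h5 : ((2 : ℝ) ^ m - 2 ^ n) * iteratedFDeriv ℝ n (evalAt P.poly) 0 v = 0 := by linarith
  exact (mul_eq_zero.1 h5).resolve_left (sub_ne_zero.2 h4)

/-- On the line through `x` the polynomial is `t ↦ tⁿ P(x)`, whose `n`-th derivative at `0` is `n!
P(x)`. -/
theorem eq_zero_of_jet_eq_zero {n : ℕ} {P : Harm d n} (h : jet d n (restrictDisk d n P) = 0) :
    P = 0 := by
  rw [jet_restrictDisk] at h
  refine Subtype.ext (show P.poly = 0 from eq_zero_of_evalAt_eq_zero_ball one_pos fun x _ => ?_)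
  let g : ℝ →L[ℝ] Space d := ContinuousLinearMap.toSpanSingleton ℝ x
  have hg : evalAt P.poly ∘ g = fun t : ℝ => t ^ n * evalAt P.poly x := by
    ext t
    simpa [g] using evalAt_smul P t x
  have h1 := g.iteratedFDeriv_comp_right (contDiff_evalAt P.poly) 0 (i := n) le_rfl
  rw [map_zero, h] at h1
  have h2 : iteratedDeriv n (evalAt P.poly ∘ g) 0 = 0 := by
    rw [iteratedDeriv_eq_iteratedFDeriv, h1]; rfl
  rw [hg, iteratedDeriv_mul_const_field, iteratedDeriv_pow] at h2
  have h3 : (n.factorial : ℝ) ≠ 0 := by positivity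
  simpa [Nat.descFactorial_self, h3] using h2

/-! ### Components of elements of `H_CFT`. -/

/-- The inclusion `Harm_{d,n} → Harm_d`. -/
def HarmSum.of (n : ℕ) : Harm d n →ₗ[ℝ] HarmSum d :=
  DirectSum.lof ℝ ℕ (fun n => Harm d n) n

theorem HarmSum.component_of_same (n : ℕ) (t : Harm d n) : (HarmSum.of n t).component n = t :=
  DirectSum.component.lof_self ℝ n t

theorem HarmSum.component_of_ne {m n : ℕ} (h : n ≠ m) (t : Harm d n) :
    (HarmSum.of n t).component m = 0 :=
  (DirectSum.component.of ℝ m n t).trans (dif_neg h)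

theorem HarmSum.induction {motive : HarmSum d → Prop} (zero : motive 0)
    (of : ∀ n t, motive (HarmSum.of n t)) (add : ∀ u v, motive u → motive v → motive (u + v))
    (u : HarmSum d) : motive u :=
  DirectSum.induction_on u zero of add

variable [Fact (3 ≤ d)]

theorem inner_of (n : ℕ) (t : Harm d n) (u : HarmSum d) :
    inner ℝ (HarmSum.of n t) u = cftWeight d n * inner ℝ t (u.component n) := by
  rw [inner_harmSum, cftForm, finsum_eq_single _ n, HarmSum.component_of_same, inner_harm]
  intro m hm
  rw [HarmSum.component_of_ne hm.symm, ← inner_harm, inner_zero_left, mul_zero]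

/-- The weight is at most `2(n + 1)` because `d - 2 ≥ 1`, and this is at most its own square. The
crude bound suffices against geometric decay. -/
theorem norm_of_le (n : ℕ) (t : Harm d n) : ‖HarmSum.of n t‖ ≤ 2 * ((n : ℝ) + 1) * ‖t‖ := by
  have hd : (3 : ℝ) ≤ d := by exact_mod_cast Fact.out (p := 3 ≤ d)
  have hn : (0 : ℝ) ≤ n := n.cast_nonneg
  have hw : cftWeight d n ≤ 2 * ((n : ℝ) + 1) := by
    rw [cftWeight, div_le_iff₀ (by linarith)]
    nlinarith
  refine abs_le_of_sq_le_sq' ?_ (by positivity) |>.2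
  rw [← real_inner_self_eq_norm_sq, inner_of, HarmSum.component_of_same,
    real_inner_self_eq_norm_sq, mul_pow]
  gcongr
  nlinarith

theorem continuous_cftExpansion (n : ℕ) : Continuous fun h : HCFT d => cftExpansion d h n :=
  ((componentL d n).extend (UniformSpace.Completion.toComplL (𝕜 := ℝ))).continuous

theorem inner_coe_of (n : ℕ) (t : Harm d n) (h : HCFT d) :
    inner ℝ (HarmSum.of n t : HCFT d) h = cftWeight d n * inner ℝ t (cftExpansion d h n) := by
  induction h using UniformSpace.Completion.induction_on with
  | hp =>
    exact isClosed_eq (continuous_const.inner continuous_id)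
      (continuous_const.mul (continuous_const.inner (continuous_cftExpansion n)))
  | ih u => rw [UniformSpace.Completion.inner_coe, inner_of, cftExpansion_coe]

/-- By `inner_coe_of`, the pairing with an element of `Harm_{d,n}` sees only the component of degree
`n`. If all components vanish, the vector is orthogonal to the dense subspace `Harm_d`, hence zero.
-/
theorem cftExpansion_injective (d : ℕ) [Fact (3 ≤ d)] : Function.Injective (cftExpansion d) := by
  rw [injective_iff_map_eq_zero]
  intro h hh
  have key : ∀ x : HCFT d, inner ℝ x h = 0 := fun x => by
    induction x using UniformSpace.Completion.induction_on with
    | hp => exact isClosed_eq (continuous_id.inner continuous_const) continuous_const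
    | ih u =>
      induction u using HarmSum.induction with
      | zero => rw [UniformSpace.Completion.coe_zero, inner_zero_left]
      | of n t => rw [inner_coe_of, hh, Pi.zero_apply, inner_zero_right, mul_zero]
      | add u v hu hv => rw [UniformSpace.Completion.coe_add, inner_add_left, hu, hv, add_zero]
  exact inner_self_eq_zero.1 (key h)

theorem cftExpansion_of_same (n : ℕ) (t : Harm d n) :
    cftExpansion d (HarmSum.of n t : HCFT d) n = t := by
  rw [cftExpansion_coe, HarmSum.component_of_same]

theorem cftExpansion_of_ne {m n : ℕ} (h : n ≠ m) (t : Harm d n) :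
    cftExpansion d (HarmSum.of n t : HCFT d) m = 0 := by
  rw [cftExpansion_coe, HarmSum.component_of_ne h]

/-- The hypothesis makes `∑ tₙ` absolutely convergent in `H_CFT`, and the continuous component maps
can be applied term by term. -/
theorem mem_range_cftExpansion {t : (n : ℕ) → Harm d n}
    (ht : Summable fun n : ℕ => 2 * ((n : ℝ) + 1) * ‖t n‖) :
    t ∈ LinearMap.range (cftExpansion d) := by
  have hs : Summable fun n => (HarmSum.of n (t n) : HCFT d) :=
    Summable.of_norm_bounded ht fun n => by
      rw [UniformSpace.Completion.norm_coe]; exact norm_of_le n (t n)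
  refine ⟨∑' n, (HarmSum.of n (t n) : HCFT d), funext fun m => ?_⟩
  let c : HCFT d →L[ℝ] Harm d m :=
    (componentL d m).extend (UniformSpace.Completion.toComplL (𝕜 := ℝ))
  have hc : ∀ h, cftExpansion d h m = c h := fun h => rfl
  rw [hc, c.map_tsum hs, tsum_eq_single m fun n hn => by rw [← hc, cftExpansion_of_ne hn], ← hc,
    cftExpansion_of_same]

/-! ### The inclusion of `H'(𝔻)` in `H_CFT` and its density. -/

theorem range_dualExpansion_le (d : ℕ) [Fact (3 ≤ d)] :
    LinearMap.range (dualExpansion d) ≤ LinearMap.range (cftExpansion d) := by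
  rintro _ ⟨T, rfl⟩
  obtain ⟨r, C, hr0, hr1, h⟩ := norm_dualExpansion_le T
  refine mem_range_cftExpansion ?_
  -- The exponent is `d` from the decay estimate plus one from the CFT norm. The sum is the shifted
  -- series `∑ k ^ (d + 1) r ^ k` divided by `r`.
  have hs : Summable fun n : ℕ => ((n : ℝ) + 1) ^ (d + 1) * r ^ n := by
    have h1 := (summable_nat_add_iff 1).2 (summable_pow_mul_geometric_of_norm_lt_one (d + 1)
      (r := r) (by rwa [Real.norm_of_nonneg hr0.le]))
    refine (h1.mul_right r⁻¹).congr fun n => ?_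
    push_cast
    field_simp
    ring
  refine Summable.of_nonneg_of_le (fun n => mul_nonneg (by positivity) (norm_nonneg (dualExpansion d T n)))
    (fun n => ?_) (hs.mul_left (2 * C))
  calc 2 * ((n : ℝ) + 1) * ‖dualExpansion d T n‖
      ≤ 2 * ((n : ℝ) + 1) * (C * (((n : ℝ) + 1) ^ d * r ^ n)) := by gcongr; exact h n
    _ = 2 * C * (((n : ℝ) + 1) ^ (d + 1) * r ^ n) := by ring

/-- The `n`-jet at the origin is injective on `Harm_{d,n}`, so `u ↦ (t, u)` factors through it;
Hahn–Banach extends the resulting functional to all multilinear forms. Composed with the jet, it is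
continuous on `H(𝔻)` and kills the other degrees. -/
theorem exists_dualExpansion_eq (n : ℕ) (t : Harm d n) :
    ∃ T : HarmonicDual d, dualExpansion d T = cftExpansion d (HarmSum.of n t : HCFT d) := by
  let L := (jet d n).toLinearMap ∘ₗ restrictDisk d n
  have hL : Function.Injective L := (injective_iff_map_eq_zero L).2 fun P hP =>
    eq_zero_of_jet_eq_zero hP
  let e := LinearEquiv.ofInjective L hL
  obtain ⟨g, hg, -⟩ := exists_extension_norm_eq (LinearMap.range L)
    (LinearMap.toContinuousLinearMap (innerₛₗ ℝ t ∘ₗ e.symm.toLinearMap))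
  refine ⟨g ∘L jet d n, funext fun m => ?_⟩
  refine ext_inner_right ℝ fun u => ?_
  rw [inner_harm, dualExpansion_spec]
  rcases eq_or_ne n m with rfl | h
  · rw [cftExpansion_of_same]
    have : g (e u) = inner ℝ t u := by simpa using hg (e u)
    exact this
  · rw [cftExpansion_of_ne h, inner_zero_left, ContinuousLinearMap.comp_apply,
      jet_restrictDisk_of_ne h.symm, map_zero]

/-- The inclusion `H'(𝔻) → H_CFT`. -/
def dualInclusion (d : ℕ) [Fact (3 ≤ d)] : HarmonicDual d →ₗ[ℝ] HCFT d :=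
  (LinearEquiv.ofInjective (cftExpansion d) (cftExpansion_injective d)).symm.toLinearMap ∘ₗ
    (dualExpansion d).codRestrict _ fun T => range_dualExpansion_le d ⟨T, rfl⟩

theorem cftExpansion_dualInclusion (T : HarmonicDual d) :
    cftExpansion d (dualInclusion d T) = dualExpansion d T :=
  congrArg Subtype.val ((LinearEquiv.ofInjective (cftExpansion d)
    (cftExpansion_injective d)).apply_symm_apply _)

theorem dualInclusion_injective (d : ℕ) [Fact (3 ≤ d)] : Function.Injective (dualInclusion d) :=
  fun T S h => dualExpansion_injective d <| by
    rw [← cftExpansion_dualInclusion, h, cftExpansion_dualInclusion]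

/-- The range already contains `Harm_d`, whose homogeneous elements are supplied by
`exists_dualExpansion_eq`. -/
theorem dualInclusion_denseRange (d : ℕ) [Fact (3 ≤ d)] : DenseRange (dualInclusion d) := by
  have h : ∀ u : HarmSum d, (u : HCFT d) ∈ LinearMap.range (dualInclusion d) := fun u => by
    induction u using HarmSum.induction with
    | zero => exact zero_mem _
    | of n t =>
      obtain ⟨T, hT⟩ := exists_dualExpansion_eq n t
      exact ⟨T, cftExpansion_injective d (by rw [cftExpansion_dualInclusion, hT])⟩
    | add u v hu hv => rw [UniformSpace.Completion.coe_add]; exact add_mem hu hv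
  exact UniformSpace.Completion.denseRange_coe.mono (Set.range_subset_iff.2 h)

end

end CFT

theorem mainTheorem7 (d : ℕ) [Fact (3 ≤ d)] :
    Function.Injective (CFT.dualExpansion d) ∧
    Function.Injective (CFT.cftExpansion d) ∧
    LinearMap.range (CFT.dualExpansion d) ≤ LinearMap.range (CFT.cftExpansion d) ∧
    ∃ j : CFT.HarmonicDual d →ₗ[ℝ] CFT.HCFT d,
      (∀ T, CFT.cftExpansion d (j T) = CFT.dualExpansion d T) ∧
      Function.Injective (Fock.toFock j) ∧
      DenseRange (Fock.toFock j) :=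
  ⟨CFT.dualExpansion_injective d, CFT.cftExpansion_injective d, CFT.range_dualExpansion_le d,
    CFT.dualInclusion d, CFT.cftExpansion_dualInclusion,
    Fock.toFock_injective (CFT.dualInclusion_injective d),
    Fock.toFock_denseRange (CFT.dualInclusion_denseRange d)⟩
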